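/- A mixed graph $G=(V,E_{\to},E_{\leftrightarrow})$ has a finite vertex set $V$, a set $E_{\to}$ of directed edges $u\to v$ with $u\neq v$, and a set $E_{\leftrightarrow}$ of bi-directed edges $u\leftrightarrow v$ (unordered pairs of distinct vertices). For $i\in V$ let $\mathrm{pa}(i)=\{j: j\to i\in E_{\to}\}$ and $\mathrm{sib}(i)=\{j: j\leftrightarrow i\in E_{\leftrightarrow}\}$, and let $G_{-i}$ be the subgraph induced on $V\setminus\{i\}$. A half-collider path is a path, with vertices $i_1,\dots,i_k$ ($k\ge 1$) that need not be distinct, either with all edges bi-directed, or with first edge $i_1\to i_2$ and all other edges bi-directed; a single vertex and a single directed edge are included. Its bi-directed portion is $\{i_1,\dots,i_k\}$ in the first case and $\{i_2,\dots,i_k\}$ in the second. A system of half-collider paths from $S_b$ to $S_e$, where $|S_b|=|S_e|=s$, consists of $s$ half-collider paths, each from a vertex of $S_b$ to a vertex of $S_e$, such that every vertex of $S_b$ is the first vertex of some path and every vertex of $S_e$ is the last vertex of some path. Consider the following condition on $G$: (a) For all $i\in V$, the graph $G_{-i}$ contains a system of half-collider paths from a subset of $V\setminus(\mathrm{pa}(i)\cup\{i\})$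 to $\mathrm{sib}(i)$ such that the bi-directed portions are pairwise disjoint. **Proposition.** For any mixed graph $G=(V,E_{\to},E_{\leftrightarrow})$, condition (a) can be checked in $\mathcal{O}(|V|^5)$ operations. That is, there is a single program for a random access machine which, given $|V|$ and the adjacency matrices of the directed and of the bi-directed edges with respect to any numbering of $V$, always halts after $\mathcal{O}(|V|^5)$ elementary operations and outputs $1$ if (a) holds and $0$ otherwise. Here an elementary operation is an access to a constant, a register or a memory cell, an addition, truncated subtraction, multiplication or comparison of natural numbers, an assignment or a test, and all numbers and addresses that occur are less than $(|V|+2)^c$ for a constant $c$, i.e. words have $\mathcal{O}(\log |V|)$ bits. -/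

import Mathlib

/-! ### Mixed graphs and half-collider paths -/

/-- A mixed graph on the vertex set `V`: a set of directed edges (ordered pairs, no self-loops)
and a set of bi-directed edges (unordered pairs of distinct vertices). The same two vertices may
be joined by several edges, e.g. by `u → v`, `v → u` and `u ↔ v`. -/
structure MixedGraph (V : Type*) where
  /-- `Dir u v` means that `u → v` is an edge. -/
  Dir : V → V → Prop
  /-- `Bi.Adj u v` means that `u ↔ v` is an edge. -/
  Bi : SimpleGraph V
  dir_irrefl : ∀ v, ¬ Dir v v

namespace MixedGraph

variable {V : Type*}

/-- The parents of `i`. -/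
def pa (G : MixedGraph V) (i : V) : Set V := {j | G.Dir j i}

/-- The siblings of `i`. -/
def sib (G : MixedGraph V) (i : V) : Set V := {j | G.Bi.Adj j i}

/-- The subgraph induced on a set of vertices. -/
def induce (G : MixedGraph V) (S : Set V) : MixedGraph S where
  Dir u v := G.Dir u v
  Bi := G.Bi.induce S
  dir_irrefl v := G.dir_irrefl v

/-- Half-collider paths from `u` to `v`: either all edges are bi-directed, or the first edge is
directed and all others are bi-directed. Vertices may repeat; the empty path `u` and a single
directed edge `u → v` are included. -/
inductive HalfColliderPath (G : MixedGraph V) : V → V → Type _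
  | bidirected {u v : V} (p : G.Bi.Walk u v) : HalfColliderPath G u v
  | directed {u m v : V} (h : G.Dir u m) (p : G.Bi.Walk m v) : HalfColliderPath G u v

/-- The bi-directed portion: all vertices of the path, except that the first one is dropped when
the path starts with a directed edge (it may of course come back later on the path). -/
def HalfColliderPath.portion {G : MixedGraph V} {u v : V} : G.HalfColliderPath u v → Set V
  | .bidirected p => {x | x ∈ p.support}
  | .directed _ p => {x | x ∈ p.support}

/-- A system of half-collider paths from `Sb` to `Se`: as many paths as `Sb` and as `Se` have
elements, each from a vertex of `Sb` to a vertex of `Se`, such that every vertex of `Sb` is the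
first vertex of some path and every vertex of `Se` is the last vertex of some path. -/
structure HalfColliderSystem (G : MixedGraph V) (Sb Se : Set V) where
  size : ℕ
  card_first : Sb.ncard = size
  card_last : Se.ncard = size
  first : Fin size → V
  last : Fin size → V
  path : ∀ l, G.HalfColliderPath (first l) (last l)
  range_first : Set.range first = Sb
  range_last : Set.range last = Se

/-- For every vertex `i`, the induced subgraph on `V \ {i}` contains a system of half-collider
paths from a subset of `V \ (pa(i) ∪ {i})` to `sib(i)` whose bi-directed portions are pairwise
disjoint. -/
def GraphicalCondition (G : MixedGraph V) : Prop :=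
  ∀ i : V, ∃ Sb : Set ({i}ᶜ : Set V), Sb ⊆ Subtype.val ⁻¹' (G.pa i ∪ {i})ᶜ ∧
    ∃ S : (G.induce {i}ᶜ).HalfColliderSystem Sb (Subtype.val ⁻¹' G.sib i),
      Pairwise fun k l => Disjoint (S.path k).portion (S.path l).portion

end MixedGraph

/-! ### A random access machine with a step count

Programs are finite, with finitely many registers and a random access memory, both holding natural
numbers. Every elementary operation (reading a constant, a register or a memory cell, an
arithmetic operation or comparison, an assignment, a test) costs one step. There is a word bound
`W`: an execution is only valid if every value that is computed, including every address, is
smaller than `W`. -/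

namespace RAM

/-- Contents of the registers and of the memory. -/
structure State where
  reg : ℕ → ℕ
  mem : ℕ → ℕ

inductive Expr
  | const (k : ℕ)
  | reg (r : ℕ)
  | load (a : Expr)
  | add (a b : Expr)
  | sub (a b : Expr)
  | mul (a b : Expr)
  | lt (a b : Expr)
  | eq (a b : Expr)

/-- The value of an expression. Subtraction is truncated at `0`; a comparison yields `0` or `1`. -/
def Expr.val (s : State) : Expr → ℕ
  | .const k => k
  | .reg r => s.reg r
  | .load a => s.mem (a.val s)
  | .add a b => a.val s + b.val s
  | .sub a b => a.val s - b.val s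
  | .mul a b => a.val s * b.val s
  | .lt a b => if a.val s < b.val s then 1 else 0
  | .eq a b => if a.val s = b.val s then 1 else 0

/-- The number of operations for the evaluation of an expression. -/
def Expr.cost : Expr → ℕ
  | .const _ => 1
  | .reg _ => 1
  | .load a => a.cost + 1
  | .add a b => a.cost + b.cost + 1
  | .sub a b => a.cost + b.cost + 1
  | .mul a b => a.cost + b.cost + 1
  | .lt a b => a.cost + b.cost + 1
  | .eq a b => a.cost + b.cost + 1

/-- All values that occur in the evaluation of an expression are smaller than `W`. -/
def Expr.Fits (W : ℕ) (s : State) : Expr → Prop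
  | .const k => k < W
  | .reg r => s.reg r < W
  | .load a => a.Fits W s ∧ s.mem (a.val s) < W
  | .add a b => a.Fits W s ∧ b.Fits W s ∧ a.val s + b.val s < W
  | .sub a b => a.Fits W s ∧ b.Fits W s
  | .mul a b => a.Fits W s ∧ b.Fits W s ∧ a.val s * b.val s < W
  | .lt a b => a.Fits W s ∧ b.Fits W s ∧ 1 < W
  | .eq a b => a.Fits W s ∧ b.Fits W s ∧ 1 < W

inductive Prog
  | skip
  | assign (r : ℕ) (e : Expr)
  | store (a e : Expr)
  | seq (p q : Prog)
  | ite (b : Expr) (p q : Prog)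
  | loop (b : Expr) (p : Prog)

/-- `Exec W p s t s'`: with word bound `W`, the program `p` started in the state `s` halts after
exactly `t` steps in the state `s'`. -/
inductive Exec (W : ℕ) : Prog → State → ℕ → State → Prop
  | skip (s : State) : Exec W .skip s 1 s
  | assign (r : ℕ) (e : Expr) (s : State) (he : e.Fits W s) :
      Exec W (.assign r e) s (e.cost + 1) { s with reg := Function.update s.reg r (e.val s) }
  | store (a e : Expr) (s : State) (ha : a.Fits W s) (he : e.Fits W s) :
      Exec W (.store a e) s (a.cost + e.cost + 1)
        { s with mem := Function.update s.mem (a.val s) (e.val s) }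
  | seq {p q : Prog} {s s' s'' : State} {t t' : ℕ} (hp : Exec W p s t s')
      (hq : Exec W q s' t' s'') : Exec W (.seq p q) s (t + t') s''
  | ite_true {b : Expr} {p q : Prog} {s s' : State} {t : ℕ} (hf : b.Fits W s)
      (hb : b.val s ≠ 0) (hp : Exec W p s t s') : Exec W (.ite b p q) s (b.cost + 1 + t) s'
  | ite_false {b : Expr} {p q : Prog} {s s' : State} {t : ℕ} (hf : b.Fits W s)
      (hb : b.val s = 0) (hq : Exec W q s t s') : Exec W (.ite b p q) s (b.cost + 1 + t) s'
  | loop_true {b : Expr} {p : Prog} {s s' s'' : State} {t t' : ℕ} (hf : b.Fits W s)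
      (hb : b.val s ≠ 0) (hp : Exec W p s t s') (hl : Exec W (.loop b p) s' t' s'') :
      Exec W (.loop b p) s (b.cost + 1 + t + t') s''
  | loop_false {b : Expr} {p : Prog} {s : State} (hf : b.Fits W s) (hb : b.val s = 0) :
      Exec W (.loop b p) s (b.cost + 1) s

/-- The machine is deterministic: the number of steps and the final state are determined by the
program and the initial state. -/
theorem Exec.deterministic {W : ℕ} {p : Prog} {s s₁ s₂ : State} {t₁ t₂ : ℕ}
    (h₁ : Exec W p s t₁ s₁) (h₂ : Exec W p s t₂ s₂) : t₁ = t₂ ∧ s₁ = s₂ := by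
  induction h₁ generalizing t₂ s₂ with
  | skip s => cases h₂; exact ⟨rfl, rfl⟩
  | assign r e s he => cases h₂; exact ⟨rfl, rfl⟩
  | store a e s ha he => cases h₂; exact ⟨rfl, rfl⟩
  | seq hp hq ihp ihq =>
    cases h₂ with
    | seq hp' hq' =>
      obtain ⟨rfl, rfl⟩ := ihp hp'
      obtain ⟨rfl, rfl⟩ := ihq hq'
      exact ⟨rfl, rfl⟩
  | ite_true hf hb hp ih =>
    cases h₂ with
    | ite_true _ _ hp' => obtain ⟨rfl, rfl⟩ := ih hp'; exact ⟨rfl, rfl⟩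
    | ite_false _ hb' _ => exact absurd hb' hb
  | ite_false hf hb hp ih =>
    cases h₂ with
    | ite_true _ hb' _ => exact absurd hb hb'
    | ite_false _ _ hp' => obtain ⟨rfl, rfl⟩ := ih hp'; exact ⟨rfl, rfl⟩
  | loop_true hf hb hp hl ihp ihl =>
    cases h₂ with
    | loop_true _ _ hp' hl' =>
      obtain ⟨rfl, rfl⟩ := ihp hp'
      obtain ⟨rfl, rfl⟩ := ihl hl'
      exact ⟨rfl, rfl⟩
    | loop_false _ hb' => exact absurd hb' hb
  | loop_false hf hb =>
    cases h₂ with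
    | loop_true _ hb' _ _ => exact absurd hb hb'
    | loop_false _ _ => exact ⟨rfl, rfl⟩

end RAM

open Classical in
/-- The input for a mixed graph whose vertices are numbered `0, …, n - 1` by `e`: register `0`
holds `n`, the cells `0, …, n² - 1` hold the adjacency matrix of the directed edges and the cells
`n², …, 2n² - 1` that of the bi-directed edges, row by row; everything else is `0`. -/
noncomputable def MixedGraph.input {V : Type*} {n : ℕ} (G : MixedGraph V) (e : V ≃ Fin n) :
    RAM.State where
  reg r := if r = 0 then n else 0
  mem a :=
    if (∃ u v, G.Dir u v ∧ a = (e u : ℕ) * n + e v) ∨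
        (∃ u v, G.Bi.Adj u v ∧ a = n * n + ((e u : ℕ) * n + e v)) then 1 else 0

/-! Fix a vertex `i` and put `A = V \ (pa(i) ∪ {i})`, `S = sib(i)`. A disjoint system is encoded by
predecessors: every `w ≠ i` is matched with `inl u` if `w` opens the portion of a path that starts
at `u ∈ A`, with `inr u` if `w` follows `u ∉ S` inside a portion, and with `inr w` if no chosen path
covers it. Disjointness makes this choice injective (`exists_injective_isPred_of_system`).
Conversely, follow an injective choice of predecessors backwards from `S`. Since no `inr u` with `u
∈ S` is used, two chains cannot merge and no chain can cycle, so by finiteness each one reaches a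
first vertex (`exists_system_of_injective_isPred`). Thus (a) asks, for each of the `n` vertices,
whether `n` bidders can be matched into `2n` objects.

Each matching problem is decided by an auction with unit increments. A bidder without an object
takes the cheapest compatible one, if its price is below `n`, and raises that price by one; a
previous owner loses it. An owner never pays more than one above the cheapest alternative, and this
slack turns a bidder that is priced out into a violation of Hall's condition
(`AuctionInv.not_hasMatching`). Prices are at most `n`, so the total price is at most `2n²`, and
every round raises it unless the auction is over. Hence `2n² + 1` rounds of `n` bids, each with a
search of `O(n)` steps, suffice: `O(n⁴)` per vertex and `O(n⁵)` altogether. -/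

/-! ### The auction algorithm for bipartite matching -/

/-- Invariants of the auction algorithm that matches the bidders `l < n` with the objects `r < 2n`
along the relation `adj`: `p r` is the price of `r`, `o r` is `l + 1` if `l` owns `r`, and `m l` is
the last object that `l` has bought, so that `l` owns an object iff `o (m l) = l + 1`. -/
structure AuctionInv (n : ℕ) (adj : ℕ → ℕ → Prop) (m o p : ℕ → ℕ) : Prop where
  m_lt : ∀ l < n, m l < 2 * n
  p_le : ∀ r < 2 * n, p r ≤ n
  owner : ∀ r < 2 * n, p r ≠ 0 → ∃ l < n, o r = l + 1 ∧ m l = r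
  o_zero : ∀ r < 2 * n, p r = 0 → o r = 0
  adj_m : ∀ l < n, o (m l) = l + 1 → adj l (m l)
  slack : ∀ l < n, o (m l) = l + 1 → ∀ r < 2 * n, adj l r → p (m l) ≤ p r + 1

/-- All bidders below `n` can be matched with distinct objects. -/
def HasMatching (n : ℕ) (adj : ℕ → ℕ → Prop) : Prop :=
  ∃ g : ℕ → ℕ, Set.InjOn g (Set.Iio n) ∧ ∀ l < n, g l < 2 * n ∧ adj l (g l)

/-- Either everyone owns an object, or some bidder without an object can no longer afford any. -/
def AuctionDone (n : ℕ) (adj : ℕ → ℕ → Prop) (m o p : ℕ → ℕ) : Prop :=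
  (∀ l < n, o (m l) = l + 1) ∨
    ∃ l < n, o (m l) ≠ l + 1 ∧ ∀ r < 2 * n, adj l r → n ≤ p r

namespace AuctionInv

variable {n : ℕ} {adj : ℕ → ℕ → Prop} {m o p : ℕ → ℕ}

theorem init (n : ℕ) (adj : ℕ → ℕ → Prop) (hm : ∀ r < 2 * n, m r = 0) (ho : ∀ r < 2 * n, o r = 0)
    (hp : ∀ r < 2 * n, p r = 0) : AuctionInv n adj m o p := by
  refine ⟨fun l hl => ?_, fun r hr => ?_, fun r hr h => absurd (hp r hr) h, fun r hr _ => ho r hr,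
    fun l hl h => ?_, fun l hl h => ?_⟩
  · rw [hm l (by omega)]; omega
  · rw [hp r hr]; omega
  -- Owner marks are shifted by one, so the mark `0` means that nobody owns the object, although
  -- every `m l` points to object `0`.
  all_goals rw [hm l (by omega), ho 0 (by omega)] at h; omega

theorem o_le (h : AuctionInv n adj m o p) {r : ℕ} (hr : r < 2 * n) : o r ≤ n := by
  by_cases h0 : p r = 0
  · rw [h.o_zero r hr h0]; omega
  · obtain ⟨l, hl, h1, -⟩ := h.owner r hr h0
    omega

/-- Prices only rise, so the slack of the other owners survives; the buyer has it because `r` was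
cheapest. A previous owner `l'` keeps `m l' = r`, but the overwritten mark shows that the object is
lost. -/
theorem step (h : AuctionInv n adj m o p) {l r : ℕ} (hl : l < n) (hlm : o (m l) ≠ l + 1)
    (hr : r < 2 * n) (ha : adj l r) (hpr : p r < n)
    (hmin : ∀ r' < 2 * n, adj l r' → p r ≤ p r') :
    AuctionInv n adj (Function.update m l r) (Function.update o r (l + 1))
      (Function.update p r (p r + 1)) := by
  refine ⟨fun l' hl' => ?_, fun r' hr' => ?_, fun r' hr' h0 => ?_, fun r' hr' h0 => ?_,
    fun l' hl' h0 => ?_, fun l' hl' h0 r' hr' ha' => ?_⟩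
  · by_cases e : l' = l
    · subst e; simpa using hr
    · simpa [e] using h.m_lt l' hl'
  · by_cases e : r' = r
    · subst e; simpa using hpr
    · simpa [e] using h.p_le r' hr'
  · by_cases e : r' = r
    · subst e; exact ⟨l, hl, by simp⟩
    · rw [Function.update_of_ne e] at h0
      obtain ⟨l', hl', h1, h2⟩ := h.owner r' hr' h0
      have : l' ≠ l := by rintro rfl; exact hlm (h2 ▸ h1)
      exact ⟨l', hl', by simp [e, h1], by simp [this, h2]⟩
  · by_cases e : r' = r
    · subst e; simp at h0
    · rw [Function.update_of_ne e] at h0 ⊢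
      exact h.o_zero r' hr' h0
  · by_cases e : l' = l
    · subst e; simpa using ha
    · rw [Function.update_of_ne e] at h0 ⊢
      by_cases e' : m l' = r
      · rw [e', Function.update_self] at h0; omega
      · rw [Function.update_of_ne e'] at h0
        exact h.adj_m l' hl' h0
  · have hle : p r' ≤ Function.update p r (p r + 1) r' := by
      by_cases e : r' = r
      · subst e; simp
      · simp [e]
    by_cases e : l' = l
    · subst e
      simp only [Function.update_self]
      have := hmin r' hr' ha'
      omega
    · rw [Function.update_of_ne e] at h0 ⊢
      by_cases e' : m l' = r
      · rw [e', Function.update_self] at h0; omega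
      · rw [Function.update_of_ne e'] at h0 ⊢
        have := h.slack l' hl' h0 r' hr' ha'
        omega

/-- A stuck bidder stays stuck: it is not the buyer, who can afford `r`, and prices never fall. This
allows the program to run a fixed number of rounds without testing for termination. -/
theorem done_step (h : AuctionDone n adj m o p) {l r : ℕ} (hl : l < n) (hlm : o (m l) ≠ l + 1)
    (hr : r < 2 * n) (ha : adj l r) (hpr : p r < n) :
    AuctionDone n adj (Function.update m l r) (Function.update o r (l + 1))
      (Function.update p r (p r + 1)) := by
  rcases h with h | ⟨l', hl', h1, h2⟩
  · exact absurd (h l hl) hlm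
  · have e : l' ≠ l := by
      rintro rfl
      have := h2 r hr ha
      omega
    refine Or.inr ⟨l', hl', ?_, fun r' hr' ha' => ?_⟩
    · rw [Function.update_of_ne e]
      by_cases e' : m l' = r
      · rw [e', Function.update_self]; omega
      · rwa [Function.update_of_ne e']
    · have := h2 r' hr' ha'
      by_cases e' : r' = r
      · subst e'; omega
      · rwa [Function.update_of_ne e']

theorem sum_step {r : ℕ} (hr : r < 2 * n) :
    ∑ x ∈ Finset.range (2 * n), Function.update p r (p r + 1) x =
      ∑ x ∈ Finset.range (2 * n), p x + 1 := by
  have hr' : r ∈ Finset.range (2 * n) := Finset.mem_range.2 hr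
  rw [Finset.sum_update_of_mem hr', ← Finset.add_sum_erase _ p hr', Finset.sdiff_singleton_eq_erase]
  omega

theorem sum_le (h : AuctionInv n adj m o p) :
    ∑ x ∈ Finset.range (2 * n), p x ≤ 2 * (n * n) := by
  calc _ ≤ ∑ x ∈ Finset.range (2 * n), n :=
        Finset.sum_le_sum fun r hr => h.p_le r (Finset.mem_range.1 hr)
    _ = _ := by simp; ring

/-- Objects of positive price have distinct owners other than `l`, so there are at most `n - 1` of
them and some price `k` in `1, …, n` does not occur. The owners of the objects dearer than `k`,
together with `l`, then have all their compatible objects among these, one too few for Hall's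
condition. -/
theorem not_hasMatching (h : AuctionInv n adj m o p) {l : ℕ} (hl : l < n) (hlm : o (m l) ≠ l + 1)
    (hst : ∀ r < 2 * n, adj l r → n ≤ p r) : ¬ HasMatching n adj := by
  rintro ⟨g, hg, hga⟩
  have key : ∀ r < 2 * n, p r ≠ 0 → o r - 1 < n ∧ o r - 1 ≠ l ∧ m (o r - 1) = r ∧
      o r = o r - 1 + 1 := by
    intro r hr h0
    obtain ⟨l', hl', h1, h2⟩ := h.owner r hr h0
    have e : o r - 1 = l' := by omega
    rw [e]
    exact ⟨hl', by rintro rfl; exact hlm (h2 ▸ h1), h2, h1⟩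
  set M := (Finset.range (2 * n)).filter fun r => p r ≠ 0 with hM
  have hMc : M.card ≤ n - 1 := by
    have : ((Finset.range n).erase l).card = n - 1 := by
      rw [Finset.card_erase_of_mem (Finset.mem_range.2 hl), Finset.card_range]
    rw [← this]
    refine Finset.card_le_card_of_injOn (fun r => o r - 1) (fun r hr => ?_) fun r hr r' hr' e => ?_
    · simp only [hM, Finset.coe_filter, Finset.mem_range, Set.mem_ofPred_eq] at hr
      have := key r hr.1 hr.2
      simp [this.1, this.2.1]
    · simp only [hM, Finset.coe_filter, Finset.mem_range, Set.mem_ofPred_eq] at hr hr'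
      have e' : o r - 1 = o r' - 1 := e
      rw [← (key r hr.1 hr.2).2.2.1, ← (key r' hr'.1 hr'.2).2.2.1, e']
  obtain ⟨k, hk, hkM⟩ : ∃ k ∈ Finset.Icc 1 n, k ∉ M.image p := by
    apply Finset.exists_mem_notMem_of_card_lt_card
    rw [Nat.card_Icc]
    exact lt_of_le_of_lt Finset.card_image_le (by omega)
  rw [Finset.mem_Icc] at hk
  have hpk : ∀ r < 2 * n, p r ≠ k := fun r hr e => hkM (Finset.mem_image.2
    ⟨r, by simp only [hM, Finset.mem_filter, Finset.mem_range]; omega, e⟩)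
  set N := (Finset.range (2 * n)).filter fun r => k < p r with hN
  have hNmem : ∀ r, r ∈ N ↔ r < 2 * n ∧ k < p r := by simp [hN]
  have hlN : l ∉ N.image fun r => o r - 1 := by
    intro hmem
    obtain ⟨r, hr, e⟩ := Finset.mem_image.1 hmem
    rw [hNmem] at hr
    exact (key r hr.1 (by omega)).2.1 e
  have hcard : (insert l (N.image fun r => o r - 1)).card = N.card + 1 := by
    rw [Finset.card_insert_of_notMem hlN, Finset.card_image_of_injOn]
    intro r hr r' hr' e
    have hr := (hNmem r).1 hr
    have hr' := (hNmem r').1 hr'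
    have e' : o r - 1 = o r' - 1 := e
    rw [← (key r hr.1 (by omega)).2.2.1, ← (key r' hr'.1 (by omega)).2.2.1, e']
  -- Compatible objects of `l` cost at least `n ≥ k`; those of an owner paying more than `k` cost at
  -- least `k` by the slack. As the price `k` does not occur, they all cost more than `k`.
  have hlt : ∀ x ∈ insert l (N.image fun r => o r - 1), x < n ∧ g x ∈ N := by
    intro x hx
    rcases Finset.mem_insert.1 hx with rfl | hx
    · refine ⟨hl, (hNmem _).2 ⟨(hga _ hl).1, ?_⟩⟩
      have := hst _ (hga _ hl).1 (hga _ hl).2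
      have := hpk _ (hga _ hl).1
      omega
    · obtain ⟨r, hr, rfl⟩ := Finset.mem_image.1 hx
      rw [hNmem] at hr
      obtain ⟨h1, -, h3, h4⟩ := key r hr.1 (by omega)
      refine ⟨h1, (hNmem _).2 ⟨(hga _ h1).1, ?_⟩⟩
      have := h.slack _ h1 (by rw [h3]; exact h4) _ (hga _ h1).1 (hga _ h1).2
      rw [h3] at this
      have := hpk _ (hga _ h1).1
      omega
  have := Finset.card_le_card_of_injOn g (fun x hx => (hlt x hx).2)
    fun x hx y hy e => hg (hlt x hx).1 (hlt y hy).1 e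
  omega

theorem hasMatching (h : AuctionInv n adj m o p) (hall : ∀ l < n, o (m l) = l + 1) :
    HasMatching n adj := by
  refine ⟨m, fun l hl l' hl' e => ?_, fun l hl => ⟨h.m_lt l hl, h.adj_m l hl (hall l hl)⟩⟩
  have h1 := hall l hl
  have h2 := hall l' hl'
  rw [e] at h1
  omega

theorem hasMatching_iff (h : AuctionInv n adj m o p) (hd : AuctionDone n adj m o p) :
    HasMatching n adj ↔ ∀ l < n, o (m l) = l + 1 := by
  refine ⟨fun hm => ?_, h.hasMatching⟩
  rcases hd with hd | ⟨l, hl, h1, h2⟩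
  · exact hd
  · exact absurd hm (h.not_hasMatching hl h1 h2)

end AuctionInv

/-! ### Systems of half-collider paths and matchings -/

namespace MixedGraph

variable {V : Type*}

/-- The possible predecessors of `w` in a system of half-collider paths from a subset of `A` to
`S`: `inl u` stands for `u` as a first vertex, `inr u` for `u` in a bi-directed portion. A vertex
outside of all portions is regarded as its own predecessor. -/
def IsPred (G : MixedGraph V) (A S : Set V) (w : V) : V ⊕ V → Prop
  | .inl u => u ∈ A ∧ (u = w ∨ G.Dir u w)
  | .inr u => u ∉ S ∧ (u = w ∨ G.Bi.Adj u w)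

/-- Erasing loops from the bi-directed part only shrinks the portion, so disjointness is kept, and
each vertex of the resulting path has one well-defined predecessor. -/
theorem HalfColliderPath.exists_isPath {G : MixedGraph V} {u v : V} (P : G.HalfColliderPath u v) :
    ∃ (a : V) (q : G.Bi.Walk a v), q.IsPath ∧ (∀ x ∈ q.support, x ∈ P.portion) ∧
      (u = a ∨ G.Dir u a) := by
  classical
  cases P with
  | bidirected p =>
    exact ⟨_, p.bypass, p.bypass_isPath, fun x hx => p.support_bypass_subset_support hx, .inl rfl⟩
  | directed h p =>
    exact ⟨_, p.bypass, p.bypass_isPath, fun x hx => p.support_bypass_subset_support hx, .inr h⟩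

theorem exists_injective_isPred_of_system {G : MixedGraph V} {A Sb S : Set V} (hSb : Sb ⊆ A)
    (P : G.HalfColliderSystem Sb S)
    (hP : Pairwise fun k l => Disjoint (P.path k).portion (P.path l).portion) :
    ∃ f : V → V ⊕ V, Function.Injective f ∧ ∀ w, G.IsPred A S w (f w) := by
  -- There are only as many paths as elements of `Sb`, so covering `Sb` leaves no room for
  -- repetition.
  have hfirst : Function.Injective P.first := by
    rw [← Set.injOn_univ, ← Set.ncard_image_iff Set.finite_univ, Set.image_univ, P.range_first,
      Set.ncard_univ, Nat.card_fin, P.card_first]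
  choose a q hq hqP ha using fun k => (P.path k).exists_isPath
  have hdisj : ∀ {k l x}, x ∈ (q k).support → x ∈ (q l).support → k = l := by
    intro k l x hk hl
    by_contra hne
    exact Set.disjoint_left.1 (hP hne) (hqP k x hk) (hqP l x hl)
  have hsupp : ∀ k j, (q k).getVert j ∈ (q k).support := fun k j => (q k).getVert_mem_support j
  have hlast : ∀ k, P.last k ∈ (q k).support := fun k => (q k).end_mem_support
  have hinj : ∀ {k j j'}, j ≤ (q k).length → j' ≤ (q k).length →
      (q k).getVert j = (q k).getVert j' → j = j' := fun {k j j'} h h' e => (hq k).getVert_injOn h h' e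
  let R : V → V ⊕ V → Prop := fun w x =>
    (∃ k, w = a k ∧ x = .inl (P.first k)) ∨
    (∃ k j, j < (q k).length ∧ w = (q k).getVert (j + 1) ∧ x = .inr ((q k).getVert j)) ∨
    ((∀ k, w ∉ (q k).support) ∧ x = .inr w)
  have htot : ∀ w, ∃ x, R w x := by
    intro w
    by_cases h : ∀ k, w ∉ (q k).support
    · exact ⟨_, .inr (.inr ⟨h, rfl⟩)⟩
    · push Not at h
      obtain ⟨k, hk⟩ := h
      obtain ⟨j, rfl, hj⟩ := SimpleGraph.Walk.mem_support_iff_exists_getVert.1 hk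
      cases j with
      | zero => exact ⟨_, .inl ⟨k, by simp, rfl⟩⟩
      | succ j => exact ⟨_, .inr (.inl ⟨k, j, hj, rfl, rfl⟩)⟩
  have hS : ∀ w ∈ S, ∃ k, w = P.last k := by
    intro w hw
    rw [← P.range_last] at hw
    obtain ⟨k, rfl⟩ := hw
    exact ⟨k, rfl⟩
  have hR : ∀ w x, R w x → G.IsPred A S w x := by
    rintro w x (⟨k, rfl, rfl⟩ | ⟨k, j, hj, rfl, rfl⟩ | ⟨h, rfl⟩)
    · exact ⟨hSb (P.range_first.subset (Set.mem_range_self k)), ha k⟩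
    -- A vertex of `S` is the end of some path; by disjointness it is the end of this one, so on a
    -- path without repetitions it has no successor.
    · refine ⟨fun hmem => ?_, .inr ((q k).adj_getVert_succ hj)⟩
      obtain ⟨l, hl⟩ := hS _ hmem
      have hk := hsupp k j
      rw [hl] at hk
      obtain rfl : l = k := hdisj (hlast l) hk
      have := hinj hj.le le_rfl (hl.trans (q l).getVert_length.symm)
      omega
    · refine ⟨fun hmem => ?_, .inl rfl⟩
      obtain ⟨l, hl⟩ := hS _ hmem
      exact h l (hl ▸ hlast l)
  choose f hf using htot
  refine ⟨f, fun w w' e => ?_, fun w => hR w _ (hf w)⟩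
  have h' := hf w'
  rw [← e] at h'
  rcases hf w with ⟨k, h1, h2⟩ | ⟨k, j, hj, h1, h2⟩ | ⟨h1, h2⟩ <;>
  rcases h' with ⟨k', h1', h2'⟩ | ⟨k', j', hj', h1', h2'⟩ | ⟨h1', h2'⟩ <;>
  rw [h2] at h2'
  · rw [h1, h1', hfirst (Sum.inl.inj h2')]
  · cases h2'
  · cases h2'
  · cases h2'
  · have h3 := Sum.inr.inj h2'
    obtain rfl : k = k' := hdisj (hsupp k j) (h3 ▸ hsupp k' j')
    rw [h1, h1', hinj hj.le hj'.le h3]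
  · have h3 := Sum.inr.inj h2'
    exact absurd (h3 ▸ hsupp k j) (h1' k)
  · cases h2'
  · have h3 := Sum.inr.inj h2'
    exact absurd (h3 ▸ hsupp k' j') (h1 k')
  · exact Sum.inr.inj h2'

theorem exists_system_of_injective_isPred [Finite V] {G : MixedGraph V} {A S : Set V}
    {f : V → V ⊕ V} (hf : Function.Injective f) (hpred : ∀ w, G.IsPred A S w (f w)) :
    ∃ Sb ⊆ A, ∃ P : G.HalfColliderSystem Sb S,
      Pairwise fun k l => Disjoint (P.path k).portion (P.path l).portion := by
  classical
  -- One step backwards along the chain; it stays put once a first vertex has been reached.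
  let h : V → V := fun w => Sum.elim (fun _ => w) id (f w)
  have hh : ∀ t j, (∃ u, f (h^[j] t) = .inr u) → f (h^[j] t) = .inr (h^[j + 1] t) := by
    rintro t j ⟨u, hu⟩
    rw [Function.iterate_succ_apply', hu]
    simp [h, hu]
  have hpredr : ∀ {w u}, f w = .inr u → u ∉ S ∧ (u = w ∨ G.Bi.Adj u w) := by
    intro w u e
    have := hpred w
    rwa [e] at this
  -- By injectivity of `f`, two chains that meet can be unwound one step at a time towards `S`.
  -- Neither can run out before the other, since an `inr` predecessor is never in `S`.
  have key : ∀ (j j' : ℕ) (t t' : V), t ∈ S → t' ∈ S → (∀ k < j, ∃ u, f (h^[k] t) = .inr u) →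
      (∀ k < j', ∃ u, f (h^[k] t') = .inr u) → h^[j] t = h^[j'] t' → t = t' ∧ j = j' := by
    intro j
    induction j with
    | zero =>
      intro j' t t' ht ht' H H' e
      cases j' with
      | zero => exact ⟨e, rfl⟩
      | succ j' =>
        have := hh t' j' (H' j' (by omega))
        rw [← e] at this
        exact absurd ht (hpredr this).1
    | succ j ih =>
      intro j' t t' ht ht' H H' e
      have h1 := hh t j (H j (by omega))
      cases j' with
      | zero =>
        rw [e] at h1
        exact absurd ht' (hpredr h1).1
      | succ j' =>
        have h2 := hh t' j' (H' j' (by omega))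
        rw [← e, ← h1] at h2
        obtain ⟨rfl, rfl⟩ := ih j' t t' ht ht' (fun k hk => H k (by omega))
          (fun k hk => H' k (by omega)) (hf h2.symm)
        exact ⟨rfl, rfl⟩
  have hex : ∀ t : S, ∃ j, ∃ u, f (h^[j] t) = .inl u := by
    intro t
    by_contra hno
    have H : ∀ k, ∃ u, f (h^[k] t) = .inr u := by
      intro k
      rcases e : f (h^[k] t) with u | u
      · exact absurd ⟨k, u, e⟩ hno
      · exact ⟨u, rfl⟩
    -- A chain that never reaches an `inl` would visit infinitely many distinct vertices, by `key`
    -- with `t = t'`.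
    exact not_injective_infinite_finite (fun j => h^[j] (t : V)) fun j j' e =>
      (key j j' t t t.2 t.2 (fun k _ => H k) (fun k _ => H k) e).2
  let J : S → ℕ := fun t => Nat.find (hex t)
  have hJ : ∀ t : S, ∀ k < J t, ∃ u, f (h^[k] t) = .inr u := by
    intro t k hk
    have := Nat.find_min (hex t) hk
    rcases e : f (h^[k] t) with u | u
    · exact absurd ⟨u, e⟩ this
    · exact ⟨u, rfl⟩
  choose b hb using fun t => Nat.find_spec (hex t)
  have hb : ∀ t : S, f (h^[J t] t) = .inl (b t) := hb
  have hkey : ∀ (t t' : S) (j j' : ℕ), j ≤ J t → j' ≤ J t' → h^[j] (t : V) = h^[j'] (t' : V) →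
      t = t' := fun t t' j j' hj hj' e =>
    Subtype.ext (key j j' t t' t.2 t'.2 (fun k hk => hJ t k (by omega))
      (fun k hk => hJ t' k (by omega)) e).1
  have hbinj : Function.Injective b := by
    intro t t' e
    refine hkey t t' _ _ le_rfl le_rfl (hf ?_)
    rw [hb, hb, e]
  have hbA : ∀ t, b t ∈ A ∧ (b t = h^[J t] (t : V) ∨ G.Dir (b t) (h^[J t] (t : V))) := by
    intro t
    have := hpred (h^[J t] t)
    rwa [hb] at this
  have hwalk : ∀ (t : S) (j : ℕ), j ≤ J t →
      ∃ p : G.Bi.Walk (h^[j] (t : V)) t, ∀ x ∈ p.support, ∃ k ≤ j, x = h^[k] (t : V) := by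
    intro t j
    induction j with
    | zero => exact fun _ => ⟨.nil, fun x hx => ⟨0, le_rfl, by simpa using hx⟩⟩
    | succ j ih =>
      intro hj
      obtain ⟨p, hp⟩ := ih (by omega)
      rcases (hpredr (hh t j (hJ t j (by omega)))).2 with e | e
      · rw [e]
        exact ⟨p, fun x hx => (hp x hx).imp fun k hk => ⟨by omega, hk.2⟩⟩
      · refine ⟨.cons e p, fun x hx => ?_⟩
        rw [SimpleGraph.Walk.support_cons, List.mem_cons] at hx
        rcases hx with rfl | hx
        · exact ⟨j + 1, le_rfl, rfl⟩
        · exact (hp x hx).imp fun k hk => ⟨by omega, hk.2⟩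
  have hpath : ∀ t : S, ∃ Q : G.HalfColliderPath (b t) t,
      ∀ x ∈ Q.portion, ∃ k ≤ J t, x = h^[k] (t : V) := by
    intro t
    obtain ⟨p, hp⟩ := hwalk t (J t) le_rfl
    rcases (hbA t).2 with e | e
    · rw [e]
      exact ⟨.bidirected p, hp⟩
    · exact ⟨.directed e p, hp⟩
  choose Q hQ using hpath
  let e : Fin S.ncard ≃ S := (Finite.equivFin S).symm
  have hrange : Set.range (fun l => b (e l)) = Set.range b := e.surjective.range_comp b
  refine ⟨Set.range b, by rintro _ ⟨t, rfl⟩; exact (hbA t).1,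
    { size := S.ncard
      card_first := ?_
      card_last := rfl
      first := fun l => b (e l)
      last := fun l => e l
      path := fun l => Q (e l)
      range_first := hrange
      range_last := ?_ }, fun k l hkl => Set.disjoint_left.2 fun x hk hl => hkl (e.injective ?_)⟩
  · rw [← Set.image_univ, Set.ncard_image_of_injective _ hbinj, Set.ncard_univ]
    rfl
  · exact (e.surjective.range_comp ((↑) : S → V)).trans Subtype.range_coe
  · obtain ⟨j, hj, h1⟩ := hQ _ x hk
    obtain ⟨j', hj', h2⟩ := hQ _ x hl
    exact hkey _ _ j j' hj hj' (h1.symm.trans h2)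

end MixedGraph

/-! ### Total correctness with a time bound -/

namespace RAM

/-- Replace the contents of a register. -/
def State.setReg (s : State) (r v : ℕ) : State := { s with reg := Function.update s.reg r v }

/-- Replace the contents of a memory cell. -/
def State.setMem (s : State) (a v : ℕ) : State := { s with mem := Function.update s.mem a v }

@[simp] theorem State.setReg_mem (s : State) (r v : ℕ) : (s.setReg r v).mem = s.mem := rfl

@[simp] theorem State.setMem_reg (s : State) (a v : ℕ) : (s.setMem a v).reg = s.reg := rfl

@[simp] theorem State.setReg_reg (s : State) (r v x : ℕ) :
    (s.setReg r v).reg x = if x = r then v else s.reg x := Function.update_apply ..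

/-- Started in `s`, the program halts within `T` steps in a state that satisfies `Q`. -/
def Ends (W : ℕ) (p : Prog) (s : State) (T : ℕ) (Q : State → Prop) : Prop :=
  ∃ t s', Exec W p s t s' ∧ t ≤ T ∧ Q s'

namespace Ends

variable {W T : ℕ} {s : State} {Q : State → Prop}

theorem mono {p : Prog} {T' : ℕ} {Q' : State → Prop} (h : Ends W p s T' Q') (hT : T' ≤ T)
    (hQ : ∀ s', Q' s' → Q s') : Ends W p s T Q := by
  obtain ⟨t, s', h1, h2, h3⟩ := h
  exact ⟨t, s', h1, h2.trans hT, hQ s' h3⟩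

theorem skip (hT : 1 ≤ T) (hQ : Q s) : Ends W .skip s T Q := ⟨1, s, .skip s, hT, hQ⟩

theorem assign {r : ℕ} {e : Expr} (he : e.Fits W s) (hT : e.cost + 1 ≤ T)
    (hQ : Q (s.setReg r (e.val s))) : Ends W (.assign r e) s T Q :=
  ⟨_, _, .assign r e s he, hT, hQ⟩

theorem store {a e : Expr} (ha : a.Fits W s) (he : e.Fits W s) (hT : a.cost + e.cost + 1 ≤ T)
    (hQ : Q (s.setMem (a.val s) (e.val s))) : Ends W (.store a e) s T Q :=
  ⟨_, _, .store a e s ha he, hT, hQ⟩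

theorem seq {p q : Prog} (T₁ T₂ : ℕ) (hp : Ends W p s T₁ fun s' => Ends W q s' T₂ Q)
    (hT : T₁ + T₂ ≤ T) : Ends W (.seq p q) s T Q := by
  obtain ⟨t, s', h1, h2, t', s'', h3, h4, h5⟩ := hp
  exact ⟨_, _, .seq h1 h3, by omega, h5⟩

theorem ite {b : Expr} {p q : Prog} (T₁ : ℕ) (hf : b.Fits W s)
    (hp : b.val s ≠ 0 → Ends W p s T₁ Q) (hq : b.val s = 0 → Ends W q s T₁ Q)
    (hT : b.cost + 1 + T₁ ≤ T) : Ends W (.ite b p q) s T Q := by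
  by_cases hb : b.val s = 0
  · obtain ⟨t, s', h1, h2, h3⟩ := hq hb
    exact ⟨_, _, .ite_false hf hb h1, by omega, h3⟩
  · obtain ⟨t, s', h1, h2, h3⟩ := hp hb
    exact ⟨_, _, .ite_true hf hb h1, by omega, h3⟩

end Ends

/-- `for x = 0, …, bound - 1 do body`. -/
def Prog.forLoop (x : ℕ) (bound : Expr) (body : Prog) : Prog :=
  .seq (.assign x (.const 0))
    (.loop (.lt (.reg x) bound) (.seq body (.assign x (.add (.reg x) (.const 1)))))

/-- Each iteration costs `bound.cost + 3` for the test, `B` for the body and `4` for the increment;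
the final test and the initial assignment add `bound.cost + 3` and `2`. -/
theorem Ends.forLoop {W T : ℕ} {s : State} {Q : State → Prop} {x : ℕ} {bound : Expr} {body : Prog}
    (N B : ℕ) (I : ℕ → State → Prop) (hW : N + 1 < W)
    (h0 : I 0 (s.setReg x 0))
    (hbound : ∀ k s, k ≤ N → I k s → s.reg x = k → bound.Fits W s ∧ bound.val s = N)
    (hstep : ∀ k s, k < N → I k s → s.reg x = k →
      Ends W body s B fun s' => s'.reg x = k ∧ I (k + 1) (s'.setReg x (k + 1)))
    (hQ : ∀ s, I N s → s.reg x = N → Q s)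
    (hT : N * (B + bound.cost + 7) + bound.cost + 5 ≤ T) :
    Ends W (.forLoop x bound body) s T Q := by
  have hloop : ∀ d k s, k + d = N → I k s → s.reg x = k →
      Ends W (.loop (.lt (.reg x) bound) (.seq body (.assign x (.add (.reg x) (.const 1))))) s
        (d * (B + bound.cost + 7) + bound.cost + 3) Q := by
    intro d
    induction d with
    | zero =>
      intro k s hk hI hx
      obtain ⟨h1, h2⟩ := hbound k s (by omega) hI hx
      obtain rfl : k = N := by omega
      refine ⟨_, _, .loop_false ⟨?_, h1, by omega⟩ ?_, ?_, hQ s hI hx⟩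
      · simp only [Expr.Fits]; omega
      · simp [Expr.val, hx, h2]
      · simp only [Expr.cost]; omega
    | succ d ih =>
      intro k s hk hI hx
      obtain ⟨h1, h2⟩ := hbound k s (by omega) hI hx
      obtain ⟨t, s', h3, h4, h5, h6⟩ := hstep k s (by omega) hI hx
      have hv : (Expr.add (.reg x) (.const 1)).val s' = k + 1 := by simp [Expr.val, h5]
      have h7 := Exec.assign (W := W) x (.add (.reg x) (.const 1)) s'
        (by simp only [Expr.Fits, Expr.val]; omega)
      rw [hv] at h7
      obtain ⟨t', s'', h8, h9, h10⟩ := ih (k + 1) _ (by omega) h6 (by simp)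
      refine ⟨_, _, .loop_true ⟨?_, h1, by omega⟩ ?_ (.seq h3 h7) h8, ?_, h10⟩
      · simp only [Expr.Fits]; omega
      · simp only [Expr.val, hx, h2]
        rw [if_pos (by omega)]
        exact one_ne_zero
      · rw [Nat.succ_mul]
        simp only [Expr.cost]
        omega
  refine .seq 2 (N * (B + bound.cost + 7) + bound.cost + 3) (.assign ?_ le_rfl ?_) (by omega)
  · simp only [Expr.Fits]; omega
  · exact hloop N 0 _ (by omega) h0 (by simp [Expr.val])

end RAM

/-! ### The program -/

namespace RAM

/-- The price of the object `r`, stored behind the two adjacency matrices. -/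
def price (n : ℕ) (M : ℕ → ℕ) (r : ℕ) : ℕ := M (2 * (n * n) + 3 * r + 0)

/-- The mark of the owner of the object `r`. -/
def owner (n : ℕ) (M : ℕ → ℕ) (r : ℕ) : ℕ := M (2 * (n * n) + 3 * r + 1)

/-- The object that the bidder `l` has bought last. -/
def bought (n : ℕ) (M : ℕ → ℕ) (l : ℕ) : ℕ := M (2 * (n * n) + 3 * l + 2)

/-- Assign a new price and owner to `a`, and an object to `b`. -/
def updateArrays (n : ℕ) (M : ℕ → ℕ) (a b v w z : ℕ) : ℕ → ℕ :=
  Function.update (Function.update (Function.update M (2 * (n * n) + 3 * a + 0) v)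
    (2 * (n * n) + 3 * a + 1) w) (2 * (n * n) + 3 * b + 2) z

/-- The three arrays are interleaved with stride `3`, so entries of different arrays have addresses
in different residue classes and do not collide. -/
theorem price_updateArrays (n : ℕ) (M : ℕ → ℕ) (a b v w z : ℕ) :
    price n (updateArrays n M a b v w z) = Function.update (price n M) a v := by
  funext x
  simp only [price, updateArrays, Function.update_apply]
  repeat' split
  all_goals first | rfl | omega

theorem owner_updateArrays (n : ℕ) (M : ℕ → ℕ) (a b v w z : ℕ) :
    owner n (updateArrays n M a b v w z) = Function.update (owner n M) a w := by
  funext x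
  simp only [owner, updateArrays, Function.update_apply]
  repeat' split
  all_goals first | rfl | omega

theorem bought_updateArrays (n : ℕ) (M : ℕ → ℕ) (a b v w z : ℕ) :
    bought n (updateArrays n M a b v w z) = Function.update (bought n M) b z := by
  funext x
  simp only [bought, updateArrays, Function.update_apply]
  repeat' split
  all_goals first | rfl | omega

theorem updateArrays_of_lt {n : ℕ} (M : ℕ → ℕ) (a b v w z : ℕ) {x : ℕ} (hx : x < 2 * (n * n)) :
    updateArrays n M a b v w z x = M x := by
  simp only [updateArrays, Function.update_apply]
  repeat' split
  all_goals first | rfl | omega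

/-- The bipartite graph that belongs to the vertex `i` of a mixed graph with adjacency matrices
`E`. The objects `r < n` stand for first vertices, the objects `n + u` for vertices `u` in
bi-directed portions; `i` itself is matched with one of its own copies. -/
def Compatible (E : ℕ → ℕ) (n i l r : ℕ) : Prop :=
  E (r * n + i) = 0 ∧ ((r = i ∨ r = n + i) ↔ l = i) ∧ (r = l ∨ r = n + l ∨ E (r * n + l) ≠ 0)

/-- The address of a cell in the arrays. -/
def cell (x : Expr) (c : ℕ) : Expr :=
  .add (.add (.mul (.const 2) (.mul (.reg 0) (.reg 0))) (.mul (.const 3) x)) (.const c)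

/-- Test whether the bidder in register `3` is compatible with the object in register `4`. -/
def compatibleExpr : Expr :=
  .mul (.eq (.load (.add (.mul (.reg 4) (.reg 0)) (.reg 1))) (.const 0))
    (.mul (.eq (.add (.eq (.reg 4) (.reg 1)) (.eq (.reg 4) (.add (.reg 0) (.reg 1))))
        (.eq (.reg 3) (.reg 1)))
      (.add (.add (.eq (.reg 4) (.reg 3)) (.eq (.reg 4) (.add (.reg 0) (.reg 3))))
        (.load (.add (.mul (.reg 4) (.reg 0)) (.reg 3)))))

/-- Test whether the bidder in register `3` owns an object. -/
def ownsExpr : Expr :=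
  .eq (.load (cell (.load (cell (.reg 3) 2)) 1)) (.add (.reg 3) (.const 1))

/-- Find the cheapest object for the bidder in register `3`. -/
def search : Prog :=
  .forLoop 4 (.add (.reg 0) (.reg 0))
    (.ite (.mul compatibleExpr (.lt (.load (cell (.reg 4) 0)) (.reg 6)))
      (.seq (.assign 5 (.reg 4)) (.assign 6 (.load (cell (.reg 4) 0)))) .skip)

/-- Assign a new price and owner to the object in register `a`, and an object to the bidder in
register `b`. -/
def storeArrays (a b : ℕ) (v w z : Expr) : Prog :=
  .seq (.store (cell (.reg a) 0) v) (.seq (.store (cell (.reg a) 1) w) (.store (cell (.reg b) 2) z))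

/-- Sell the object in register `5`, whose price is in register `6`, to the bidder in
register `3`. -/
def sell : Prog :=
  storeArrays 5 3 (.add (.reg 6) (.const 1)) (.add (.reg 3) (.const 1)) (.reg 5)

/-- Let the bidder in register `3` buy an object. -/
def bid : Prog :=
  .ite ownsExpr .skip
    (.seq (.assign 6 (.reg 0)) (.seq search (.ite (.lt (.reg 6) (.reg 0)) sell .skip)))

/-- One round of bids. -/
def round : Prog := .forLoop 3 (.reg 0) bid

/-- All rounds of the auction. -/
def auction : Prog :=
  .forLoop 2 (.add (.mul (.const 2) (.mul (.reg 0) (.reg 0))) (.const 1)) round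

/-- Clear the arrays. -/
def reset : Prog :=
  .forLoop 4 (.add (.reg 0) (.reg 0))
    (storeArrays 4 4 (.const 0) (.const 0) (.const 0))

/-- Clear register `7` unless every bidder owns an object. -/
def check : Prog := .forLoop 3 (.reg 0) (.ite ownsExpr .skip (.assign 7 (.const 0)))

/-- The program that checks the graphical condition. -/
def checkCondition : Prog :=
  .seq (.assign 7 (.const 1))
    (.seq (.forLoop 1 (.reg 0) (.seq reset (.seq auction check))) (.assign 0 (.reg 7)))

/-- Register `0` holds `n`, register `1` holds `i`, and the memory starts with the adjacency
matrices `E`. -/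
structure Ctx (n : ℕ) (E : ℕ → ℕ) (i : ℕ) (s : State) : Prop where
  reg_zero : s.reg 0 = n
  reg_one : s.reg 1 = i
  mem : ∀ a < 2 * (n * n), s.mem a = E a

/-- The invariant of the auction for the vertex `i`. -/
structure Good (n : ℕ) (E : ℕ → ℕ) (i : ℕ) (s : State) : Prop extends Ctx n E i s where
  inv : AuctionInv n (Compatible E n i) (bought n s.mem) (owner n s.mem) (price n s.mem)

/-! ### Correctness and running time of the program -/

theorem mul_add_lt {n r x : ℕ} (hr : r < 2 * n) (hx : x < n) : r * n + x < 2 * (n * n) := by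
  have : (r + 1) * n ≤ 2 * n * n := Nat.mul_le_mul_right n hr
  rw [Nat.succ_mul, Nat.mul_assoc] at this
  omega

variable {W n i l r : ℕ} {E : ℕ → ℕ} {s : State}

/-- Array addresses are at most `2n² + 6n + 2`; the bound in `hW` is a generous one that serves for
all values in the program. -/
theorem cell_fits (hW : 20 * (n * n) + 20 * n + 20 < W) (h0 : s.reg 0 = n) {x : Expr} {c : ℕ}
    (hc : c ≤ 2) (hx : x.Fits W s) (hxn : x.val s ≤ 2 * n) : (cell x c).Fits W s := by
  simp only [cell, Expr.Fits, Expr.val, h0]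
  have := Nat.le_mul_self n
  refine ⟨⟨⟨?_, ⟨?_, ?_, ?_⟩, ?_⟩, ⟨?_, hx, ?_⟩, ?_⟩, ?_, ?_⟩ <;> omega

theorem cell_val (h0 : s.reg 0 = n) (x : Expr) (c : ℕ) :
    (cell x c).val s = 2 * (n * n) + 3 * x.val s + c := by
  simp [cell, Expr.val, h0]

/-- Products act as conjunctions and sums as disjunctions. The equivalence becomes an equality of
sums of truth values, which is legitimate because `r = i` and `r = n + i` exclude each other. The
last factor has three terms, each at most `1`, whence the bound `3`. -/
theorem compatibleExpr_spec (hW : 20 * (n * n) + 20 * n + 20 < W) (hE : ∀ a, E a ≤ 1)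
    (hs : Ctx n E i s) (hi : i < n) (h3 : s.reg 3 = l) (hl : l < n) (h4 : s.reg 4 = r)
    (hr : r < 2 * n) : compatibleExpr.Fits W s ∧ compatibleExpr.val s ≤ 3 ∧
      (compatibleExpr.val s ≠ 0 ↔ Compatible E n i l r) := by
  have hi' := mul_add_lt hr hi
  have hl' := mul_add_lt hr hl
  have e1 := hE (r * n + i)
  have e2 := hE (r * n + l)
  have h01 : ∀ (c : Prop) [Decidable c], (if c then 1 else 0) ≤ 1 := fun c _ => by split <;> omega
  have hA : (if E (r * n + i) = 0 then 1 else 0) ≤ 1 := h01 _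
  have hB : (if (if r = i then 1 else 0) + (if r = n + i then 1 else 0) =
      (if l = i then 1 else 0) then 1 else 0) ≤ 1 := h01 _
  have hC : (if r = l then 1 else 0) + (if r = n + l then 1 else 0) + E (r * n + l) ≤ 3 := by
    split <;> split <;> omega
  have hBC := Nat.mul_le_mul hB hC
  have hABC := Nat.mul_le_mul hA hBC
  simp only [compatibleExpr, Expr.Fits, Expr.val, hs.reg_zero, hs.reg_one, h3, h4,
    hs.mem _ hi', hs.mem _ hl']
  refine ⟨?_, by omega, ?_⟩
  · have h1 : (if r = i then 1 else 0) + (if r = n + i then 1 else 0) < W := by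
      split <;> split <;> omega
    have h2 : (if r = l then 1 else 0) + (if r = n + l then 1 else 0) < W := by
      split <;> split <;> omega
    refine ⟨⟨⟨⟨⟨?_, ?_, ?_⟩, ?_, ?_⟩, ?_⟩, ?_, ?_⟩, ⟨⟨⟨⟨?_, ?_, ?_⟩, ⟨?_, ⟨?_, ?_, ?_⟩, ?_⟩, h1⟩,
      ⟨?_, ?_, ?_⟩, ?_⟩, ⟨⟨⟨?_, ?_, ?_⟩, ⟨?_, ⟨?_, ?_, ?_⟩, ?_⟩, h2⟩, ⟨⟨⟨?_, ?_, ?_⟩, ?_, ?_⟩, ?_⟩, ?_⟩,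
      ?_⟩, ?_⟩ <;> omega
  · rw [Nat.mul_ne_zero_iff, Nat.mul_ne_zero_iff, Compatible]
    refine and_congr ?_ (and_congr ?_ ?_)
    · split <;> simp_all
    · by_cases a : r = i <;> by_cases b : r = n + i <;> by_cases c : l = i <;> simp [a, b, c] <;>
        omega
    · by_cases a : r = l <;> by_cases b : r = n + l <;> simp [a, b]

theorem ownsExpr_spec (hW : 20 * (n * n) + 20 * n + 20 < W) (hs : Good n E i s)
    (h3 : s.reg 3 = l) (hl : l < n) : ownsExpr.Fits W s ∧
      (ownsExpr.val s ≠ 0 ↔ owner n s.mem (bought n s.mem l) = l + 1) := by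
  have h0 := hs.reg_zero
  have v1 : (Expr.load (cell (.reg 3) 2)).val s = bought n s.mem l := by
    simp only [Expr.val, cell_val h0, h3, bought]
  have v2 : (Expr.load (cell (.load (cell (.reg 3) 2)) 1)).val s =
      owner n s.mem (bought n s.mem l) := by
    rw [Expr.val, cell_val h0, v1, owner]
  have b1 := hs.inv.m_lt l hl
  have b2 := hs.inv.o_le b1
  have f0 : (cell (.reg 3) 2).Fits W s :=
    cell_fits hW h0 le_rfl (by simp only [Expr.Fits]; omega) (by simp only [Expr.val]; omega)
  have f1 : (Expr.load (cell (.reg 3) 2)).Fits W s := by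
    refine ⟨f0, ?_⟩
    change (Expr.load (cell (.reg 3) 2)).val s < W
    omega
  have f2 : (Expr.load (cell (.load (cell (.reg 3) 2)) 1)).Fits W s := by
    refine ⟨cell_fits hW h0 (by omega) f1 (by omega), ?_⟩
    change (Expr.load (cell (.load (cell (.reg 3) 2)) 1)).val s < W
    omega
  refine ⟨⟨f2, ?_, by omega⟩, ?_⟩
  · simp only [Expr.Fits, Expr.val]; omega
  · rw [ownsExpr, Expr.val, v2]
    simp [Expr.val, h3]

/-- Register `6` is both the running minimum and the budget: it starts at `n` and only a strictly
smaller price replaces it. If it is still `n` at the end, every compatible object costs at least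
`n`. -/
theorem ends_search (hW : 20 * (n * n) + 20 * n + 20 < W) (hE : ∀ a, E a ≤ 1)
    (hs : Ctx n E i s) (hi : i < n) (hl : l < n) (h3 : s.reg 3 = l) (h6 : s.reg 6 = n)
    (hp : ∀ r < 2 * n, price n s.mem r ≤ n) :
    Ends W search s (300 * (n + 1)) fun s' => s'.mem = s.mem ∧
      (∀ x, x ≠ 4 → x ≠ 5 → x ≠ 6 → s'.reg x = s.reg x) ∧
      (∀ r < 2 * n, Compatible E n i l r → s'.reg 6 ≤ price n s.mem r) ∧
      (s'.reg 6 = n ∨ s'.reg 6 < n ∧ s'.reg 5 < 2 * n ∧ Compatible E n i l (s'.reg 5) ∧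
        s'.reg 6 = price n s.mem (s'.reg 5)) := by
  refine .forLoop (2 * n) 100 (fun k s' => s'.mem = s.mem ∧
      (∀ x, x ≠ 4 → x ≠ 5 → x ≠ 6 → s'.reg x = s.reg x) ∧
      (∀ r < k, Compatible E n i l r → s'.reg 6 ≤ price n s.mem r) ∧
      (s'.reg 6 = n ∨ s'.reg 6 < n ∧ s'.reg 5 < 2 * n ∧ Compatible E n i l (s'.reg 5) ∧
        s'.reg 6 = price n s.mem (s'.reg 5))) (by omega) ?_ ?_ ?_ (fun s' h _ => h) ?_
  · refine ⟨rfl, fun x hx _ _ => by simp [hx], by simp, .inl (by simp [h6])⟩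
  · rintro k s' hk ⟨-, hf, -⟩ -
    have := hf 0 (by decide) (by decide) (by decide)
    simp only [Expr.Fits, Expr.val, this, hs.reg_zero]
    omega
  · rintro k s' hk ⟨hm, hf, hmin, hbest⟩ h4
    have r0 : s'.reg 0 = n := (hf 0 (by decide) (by decide) (by decide)).trans hs.reg_zero
    have r1 : s'.reg 1 = i := (hf 1 (by decide) (by decide) (by decide)).trans hs.reg_one
    have r3 : s'.reg 3 = l := (hf 3 (by decide) (by decide) (by decide)).trans h3
    have hc : Ctx n E i s' := ⟨r0, r1, fun a ha => by rw [hm]; exact hs.mem a ha⟩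
    obtain ⟨c1, c2, c3⟩ := compatibleExpr_spec hW hE hc hi r3 hl h4 hk
    have hpk := hp k hk
    have fc : ∀ s'' : State, s''.reg 0 = n → s''.reg 4 = k → (cell (.reg 4) 0).Fits W s'' :=
      fun s'' e1 e2 => cell_fits hW e1 (by omega) (by simp only [Expr.Fits]; omega)
        (by simp only [Expr.val]; omega)
    have vp : ∀ s'' : State, s''.reg 0 = n → s''.reg 4 = k → s''.mem = s.mem →
        (Expr.load (cell (.reg 4) 0)).val s'' = price n s.mem k := by
      intro s'' e1 e2 e3
      rw [Expr.val, cell_val e1, e3, Expr.val, e2, price]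
    have h6n : s'.reg 6 ≤ n := by omega
    have vlt : (Expr.lt (.load (cell (.reg 4) 0)) (.reg 6)).val s' =
        if price n s.mem k < s'.reg 6 then 1 else 0 := by
      rw [Expr.val, vp s' r0 h4 hm, Expr.val]
    have hval : (Expr.mul compatibleExpr (.lt (.load (cell (.reg 4) 0)) (.reg 6))).val s' ≠ 0 ↔
        Compatible E n i l k ∧ price n s.mem k < s'.reg 6 := by
      rw [Expr.val, vlt, Nat.mul_ne_zero_iff, c3]
      simp
    refine .ite 30 ⟨c1, ⟨⟨fc s' r0 h4, ?_⟩, ?_, by omega⟩, ?_⟩ (fun hb => ?_) (fun hb => ?_) ?_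
    · exact lt_of_eq_of_lt (vp s' r0 h4 hm) (by omega)
    · simp only [Expr.Fits]; omega
    · rw [vlt]
      split <;> omega
    · rw [hval] at hb
      refine .seq 2 20 (.assign (by simp only [Expr.Fits]; omega) (by decide) ?_) (by decide)
      have q0 : (s'.setReg 5 ((Expr.reg 4).val s')).reg 0 = n := by simp [r0]
      have q4 : (s'.setReg 5 ((Expr.reg 4).val s')).reg 4 = k := by simp [h4]
      refine .assign ⟨fc _ q0 q4, ?_⟩ (by decide) ?_
      · exact lt_of_eq_of_lt (vp _ q0 q4 hm) (by omega)
      · rw [vp _ q0 q4 hm]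
        refine ⟨by simp [h4], hm, fun x x4 x5 x6 => by simp [x4, x5, x6, hf x x4 x5 x6],
          fun r' hr' hr'' => ?_, .inr ?_⟩
        · simp only [State.setReg_reg]
          rcases Nat.lt_succ_iff_lt_or_eq.1 hr' with h | rfl
          · have := hmin r' h hr''
            simp; omega
          · simp
        · simp only [State.setReg_reg, Expr.val, h4]
          simp only [reduceIte, Nat.reduceEqDiff]
          exact ⟨by omega, hk, hb.1, trivial⟩
    · refine .skip (by omega) ⟨h4, hm, fun x x4 x5 x6 => by simp [x4, hf x x4 x5 x6],
        fun r' hr' hr'' => ?_, ?_⟩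
      · simp only [State.setReg_reg]
        rcases Nat.lt_succ_iff_lt_or_eq.1 hr' with h | rfl
        · exact hmin r' h hr''
        · have := mt hval.2 (not_not.2 hb)
          simp only [Nat.reduceEqDiff, reduceIte]
          by_contra hlt
          exact this ⟨hr'', by omega⟩
      · simpa using hbest
    · decide
  · simp only [Expr.cost]
    omega

theorem Ctx.setReg (hs : Ctx n E i s) {x : ℕ} (v : ℕ) (h0 : x ≠ 0) (h1 : x ≠ 1) :
    Ctx n E i (s.setReg x v) :=
  ⟨by simp [h0.symm, hs.reg_zero], by simp [h1.symm, hs.reg_one], hs.mem⟩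

theorem Good.setReg (hs : Good n E i s) {x : ℕ} (v : ℕ) (h0 : x ≠ 0) (h1 : x ≠ 1) :
    Good n E i (s.setReg x v) :=
  ⟨hs.toCtx.setReg v h0 h1, hs.inv⟩

/-- The memory changes between the stores, so the stored expressions must have values determined by
the registers alone. Each of the three addresses costs `11` and each store `1`, which gives `36`. -/
theorem ends_storeArrays (hW : 20 * (n * n) + 20 * n + 20 < W) (h0 : s.reg 0 = n) {a b x y : ℕ}
    (ha : s.reg a = x) (hb : s.reg b = y) (hx : x < 2 * n) (hy : y < 2 * n) {e₁ e₂ e₃ : Expr}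
    {v w z : ℕ}
    (h₁ : ∀ s', s'.reg = s.reg → e₁.Fits W s' ∧ e₁.val s' = v)
    (h₂ : ∀ s', s'.reg = s.reg → e₂.Fits W s' ∧ e₂.val s' = w)
    (h₃ : ∀ s', s'.reg = s.reg → e₃.Fits W s' ∧ e₃.val s' = z) :
    Ends W (storeArrays a b e₁ e₂ e₃) s (e₁.cost + e₂.cost + e₃.cost + 36) fun s' =>
      s'.reg = s.reg ∧ s'.mem = updateArrays n s.mem x y v w z := by
  have fits : ∀ (s' : State) (d c : ℕ), s'.reg = s.reg → s.reg d < 2 * n → c ≤ 2 →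
      (cell (.reg d) c).Fits W s' := fun s' d c e hd hc =>
    cell_fits hW (by rw [e, h0]) hc (by simp only [Expr.Fits, e]; omega)
      (by simp only [Expr.val, e]; omega)
  have val : ∀ (s' : State) (d c : ℕ), s'.reg = s.reg →
      (cell (.reg d) c).val s' = 2 * (n * n) + 3 * s.reg d + c := fun s' d c e => by
    rw [cell_val (by rw [e, h0]), Expr.val, e]
  have hcost : ∀ d c, (cell (.reg d) c).cost = 11 := fun d c => rfl
  refine .seq (e₁.cost + 12) (e₂.cost + e₃.cost + 24) (.store (fits _ _ _ rfl (by omega) (by omega))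
    (h₁ s rfl).1 (by rw [hcost]; omega) ?_) (by omega)
  rw [val s _ _ rfl, (h₁ s rfl).2]
  set s₁ := s.setMem (2 * (n * n) + 3 * s.reg a + 0) v with hs₁
  have r₁ : s₁.reg = s.reg := rfl
  refine .seq (e₂.cost + 12) (e₃.cost + 12) (.store (fits _ _ _ r₁ (by omega) (by omega))
    (h₂ s₁ r₁).1 (by rw [hcost]; omega) ?_) (by omega)
  rw [val s₁ _ _ r₁, (h₂ s₁ r₁).2]
  set s₂ := s₁.setMem (2 * (n * n) + 3 * s.reg a + 1) w with hs₂
  have r₂ : s₂.reg = s.reg := rfl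
  refine .store (fits _ _ _ r₂ (by omega) (by omega)) (h₃ s₂ r₂).1 (by rw [hcost]; omega) ⟨rfl, ?_⟩
  rw [val s₂ _ _ r₂, (h₃ s₂ r₂).2, hs₂, hs₁, ha, hb]
  rfl

theorem ends_sell (hW : 20 * (n * n) + 20 * n + 20 < W) (h0 : s.reg 0 = n) (h3 : s.reg 3 = l)
    (hl : l < n) (h5 : s.reg 5 = r) (hr : r < 2 * n) {c : ℕ} (h6 : s.reg 6 = c) (hc : c < n) :
    Ends W sell s 50 fun s' =>
      s'.reg = s.reg ∧ s'.mem = updateArrays n s.mem r l (c + 1) (l + 1) r := by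
  refine (ends_storeArrays hW h0 h5 h3 hr (by omega) (fun s' e => ?_) (fun s' e => ?_)
    (fun s' e => ?_)).mono (by decide) fun _ h => h
  all_goals simp only [Expr.Fits, Expr.val, e]
  all_goals omega

/-- The total price of all objects. -/
def totalPrice (n : ℕ) (M : ℕ → ℕ) : ℕ := ∑ r ∈ Finset.range (2 * n), price n M r

/-- The bidder `l` owns an object. -/
def Owns (n : ℕ) (M : ℕ → ℕ) (l : ℕ) : Prop := owner n M (bought n M l) = l + 1

/-- The auction for the vertex `i` is over. -/
def Done (n : ℕ) (E : ℕ → ℕ) (i : ℕ) (M : ℕ → ℕ) : Prop :=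
  AuctionDone n (Compatible E n i) (bought n M) (owner n M) (price n M)

/-- A bid either leaves the memory alone, because the bidder owns an object or is priced out, or is
a sale and raises the total price by one. This dichotomy drives the count of rounds. -/
theorem ends_bid (hW : 20 * (n * n) + 20 * n + 20 < W) (hE : ∀ a, E a ≤ 1)
    (hs : Good n E i s) (hi : i < n) (hl : l < n) (h3 : s.reg 3 = l) :
    Ends W bid s (400 * (n + 1)) fun s' => Good n E i s' ∧ s'.reg 3 = l ∧
      s'.reg 2 = s.reg 2 ∧ s'.reg 7 = s.reg 7 ∧
      ((s'.mem = s.mem ∧ (Owns n s.mem l ∨ Done n E i s.mem)) ∨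
        (totalPrice n s'.mem = totalPrice n s.mem + 1 ∧
          (Done n E i s.mem → Done n E i s'.mem))) := by
  obtain ⟨f, v⟩ := ownsExpr_spec hW hs h3 hl
  have hcost : ownsExpr.cost = 27 := by decide
  refine .ite (300 * (n + 1) + 60) f (fun hb => ?_) (fun hb => ?_) (by omega)
  · exact .skip (by omega) ⟨hs, h3, rfl, rfl, .inl ⟨rfl, .inl (v.1 hb)⟩⟩
  have hno : ¬ Owns n s.mem l := mt v.2 (not_not.2 hb)
  have h0 := hs.reg_zero
  refine .seq 2 (300 * (n + 1) + 58) (.assign (by simp only [Expr.Fits]; omega) (by decide) ?_)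
    (by omega)
  have hs1 := hs.setReg ((Expr.reg 0).val s) (x := 6) (by decide) (by decide)
  refine .seq (300 * (n + 1)) 58 ((ends_search (l := l) hW hE hs1.toCtx hi hl (by simpa using h3)
    (by simpa [Expr.val] using h0) hs1.inv.p_le).mono le_rfl ?_) (by omega)
  rintro s' ⟨hm, hf, hmin, hbest⟩
  rw [State.setReg_mem] at hm hmin hbest
  have g : ∀ x, x ≠ 4 → x ≠ 5 → x ≠ 6 → s'.reg x = s.reg x := fun x x4 x5 x6 => by
    rw [hf x x4 x5 x6, State.setReg_reg, if_neg x6]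
  have r0 : s'.reg 0 = n := by rw [g 0 (by decide) (by decide) (by decide), h0]
  have r1 : s'.reg 1 = i := by rw [g 1 (by decide) (by decide) (by decide), hs.reg_one]
  have r3 : s'.reg 3 = l := by rw [g 3 (by decide) (by decide) (by decide), h3]
  have r2 : s'.reg 2 = s.reg 2 := g 2 (by decide) (by decide) (by decide)
  have r7 : s'.reg 7 = s.reg 7 := g 7 (by decide) (by decide) (by decide)
  have hv : (Expr.lt (.reg 6) (.reg 0)).val s' = if s'.reg 6 < n then 1 else 0 := by
    rw [Expr.val, Expr.val, Expr.val, r0]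
  refine .ite 50 (by simp only [Expr.Fits]; omega) (fun hb' => ?_) (fun hb' => ?_) (by decide)
  · rw [hv] at hb'
    obtain ⟨h6, h5, hcomp, hpr⟩ := hbest.resolve_left (by intro h; simp [h] at hb')
    refine (ends_sell hW r0 r3 hl rfl h5 rfl h6).mono le_rfl ?_
    rintro s'' ⟨hr, hm'⟩
    rw [hm, hpr] at hm'
    have e1 := price_updateArrays n s.mem (s'.reg 5) l (price n s.mem (s'.reg 5) + 1) (l + 1)
      (s'.reg 5)
    have e2 := owner_updateArrays n s.mem (s'.reg 5) l (price n s.mem (s'.reg 5) + 1) (l + 1)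
      (s'.reg 5)
    have e3 := bought_updateArrays n s.mem (s'.reg 5) l (price n s.mem (s'.reg 5) + 1) (l + 1)
      (s'.reg 5)
    rw [← hm'] at e1 e2 e3
    refine ⟨⟨⟨by rw [hr, r0], by rw [hr, r1], fun a ha => ?_⟩, ?_⟩, by rw [hr, r3], by rw [hr, r2],
      by rw [hr, r7], .inr ⟨?_, fun hd => ?_⟩⟩
    · rw [hm', updateArrays_of_lt _ _ _ _ _ _ ha, hs.mem a ha]
    · rw [e1, e2, e3]
      exact hs.inv.step hl hno h5 hcomp (by omega) fun r' hr' hc' => hpr ▸ hmin r' hr' hc'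
    · rw [totalPrice, e1]
      exact AuctionInv.sum_step h5
    · rw [Done, e1, e2, e3]
      exact AuctionInv.done_step hd hl hno h5 hcomp (by omega)
  · rw [hv] at hb'
    have h6 : s'.reg 6 = n := by
      rcases hbest with h | h
      · exact h
      · simp [h.1] at hb'
    refine .skip (by omega) ⟨⟨⟨r0, r1, fun a ha => by rw [hm]; exact hs.mem a ha⟩, ?_⟩, r3, r2, r7,
      .inl ⟨hm, .inr (.inr ⟨l, hl, hno, fun r hr hc => h6 ▸ hmin r hr hc⟩)⟩⟩
    rw [hm]
    exact hs.inv

/-- As long as no sale occurs and nobody is found stuck, the memory is unchanged and all bidders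
visited so far own objects; a full round of this kind means that everyone does. -/
theorem ends_round (hW : 20 * (n * n) + 20 * n + 20 < W) (hE : ∀ a, E a ≤ 1)
    (hs : Good n E i s) (hi : i < n) {k : ℕ} (hk : k ≤ totalPrice n s.mem ∨ Done n E i s.mem) :
    Ends W round s (500 * ((n + 1) * (n + 1))) fun s' => Good n E i s' ∧
      s'.reg 2 = s.reg 2 ∧ s'.reg 7 = s.reg 7 ∧
      (k + 1 ≤ totalPrice n s'.mem ∨ Done n E i s'.mem) := by
  have hn := Nat.le_mul_self n
  refine .forLoop n (400 * (n + 1)) (fun j s' => Good n E i s' ∧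
      s'.reg 2 = s.reg 2 ∧ s'.reg 7 = s.reg 7 ∧ (k ≤ totalPrice n s'.mem ∨ Done n E i s'.mem) ∧
      (k + 1 ≤ totalPrice n s'.mem ∨ Done n E i s'.mem ∨ ∀ l < j, Owns n s'.mem l)) (by omega)
    ⟨hs.setReg 0 (by decide) (by decide), by simp, by simp, hk, .inr (.inr (by simp))⟩ ?_ ?_ ?_ ?_
  · rintro j s' hj ⟨hs', -⟩ -
    have := hs'.reg_zero
    simp only [Expr.Fits, Expr.val]
    omega
  · rintro j s' hj ⟨hs', h2, h7, hk', hj'⟩ h3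
    refine (ends_bid hW hE hs' hi hj h3).mono le_rfl ?_
    rintro s'' ⟨hs'', h3', h2', h7', ht⟩
    refine ⟨h3', hs''.setReg _ (by decide) (by decide), by simp [h2', h2], by simp [h7', h7], ?_⟩
    rw [State.setReg_mem]
    rcases ht with ⟨hm, ho⟩ | ⟨ht, hd⟩
    · rw [hm]
      refine ⟨hk', ?_⟩
      rcases hj' with h | h | h
      · exact .inl h
      · exact .inr (.inl h)
      · rcases ho with ho | ho
        · refine .inr (.inr fun l hl => ?_)
          rcases Nat.lt_succ_iff_lt_or_eq.1 hl with hl | rfl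
          · exact h l hl
          · exact ho
        · exact .inr (.inl ho)
    · rcases hk' with h | h
      · exact ⟨.inl (by omega), .inl (by omega)⟩
      · exact ⟨.inr (hd h), .inr (.inl (hd h))⟩
  · rintro s' ⟨hs', h2, h7, -, h⟩ -
    refine ⟨hs', h2, h7, ?_⟩
    rcases h with h | h | h
    · exact .inl h
    · exact .inr h
    · exact .inr (.inl h)
  · simp only [Expr.cost]
    nlinarith

theorem ends_auction (hW : 20 * (n * n) + 20 * n + 20 < W) (hE : ∀ a, E a ≤ 1)
    (hs : Good n E i s) (hi : i < n) :
    Ends W auction s (1200 * ((n + 1) * (n + 1)) * ((n + 1) * (n + 1))) fun s' => Good n E i s' ∧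
      s'.reg 7 = s.reg 7 ∧ Done n E i s'.mem := by
  refine .forLoop (2 * (n * n) + 1) (500 * ((n + 1) * (n + 1))) (fun k s' => Good n E i s' ∧
      s'.reg 7 = s.reg 7 ∧ (k ≤ totalPrice n s'.mem ∨ Done n E i s'.mem)) (by omega)
    ⟨hs.setReg 0 (by decide) (by decide), by simp, .inl (by omega)⟩ ?_ ?_ ?_ ?_
  · rintro j s' hj ⟨hs', -⟩ -
    have := Nat.le_mul_self n
    simp only [Expr.Fits, Expr.val, hs'.reg_zero]
    refine ⟨⟨⟨?_, ⟨?_, ?_, ?_⟩, ?_⟩, ?_, ?_⟩, trivial⟩ <;> omega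
  · rintro j s' hj ⟨hs', h7, hk⟩ h2
    refine (ends_round hW hE hs' hi hk).mono le_rfl ?_
    rintro s'' ⟨hs'', h2', h7', hk'⟩
    exact ⟨by rw [h2', h2], hs''.setReg _ (by decide) (by decide), by simp [h7', h7], hk'⟩
  · rintro s' ⟨hs', h7, h⟩ -
    -- A total price of `2n² + 1` would exceed the bound from prices at most `n`, so the auction
    -- must be over.
    refine ⟨hs', h7, h.resolve_left fun h => ?_⟩
    have := hs'.inv.sum_le
    rw [totalPrice] at h
    omega
  · simp only [Expr.cost]
    nlinarith [Nat.zero_le n, mul_nonneg (Nat.zero_le n) (Nat.zero_le n)]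

theorem ends_reset (hW : 20 * (n * n) + 20 * n + 20 < W) (hs : Ctx n E i s) :
    Ends W reset s (120 * (n + 1)) fun s' => Good n E i s' ∧ s'.reg 7 = s.reg 7 := by
  refine .forLoop (2 * n) 39 (fun k s' => Ctx n E i s' ∧ s'.reg 7 = s.reg 7 ∧
      ∀ x < k, price n s'.mem x = 0 ∧ owner n s'.mem x = 0 ∧ bought n s'.mem x = 0) (by omega)
    ⟨hs.setReg 0 (by decide) (by decide), by simp, by simp⟩ ?_ ?_ ?_ ?_
  · rintro j s' hj ⟨hs', -⟩ -
    simp only [Expr.Fits, Expr.val, hs'.reg_zero]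
    omega
  · rintro k s' hk ⟨hs', h7, hx⟩ h4
    refine (ends_storeArrays (v := 0) (w := 0) (z := 0) hW hs'.reg_zero h4 h4 hk hk
      (fun s' e => ?_) (fun s' e => ?_) (fun s' e => ?_)).mono (by decide) ?_
    iterate 3 · exact ⟨by simp only [Expr.Fits]; omega, rfl⟩
    rintro s'' ⟨hr, hm⟩
    have hc : Ctx n E i s'' := ⟨by rw [hr, hs'.reg_zero], by rw [hr, hs'.reg_one], fun a ha => by
      rw [hm, updateArrays_of_lt _ _ _ _ _ _ ha, hs'.mem a ha]⟩
    refine ⟨by rw [hr, h4], hc.setReg _ (by decide) (by decide), by simp [hr, h7], fun x hxk => ?_⟩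
    rw [State.setReg_mem, hm, price_updateArrays, owner_updateArrays, bought_updateArrays]
    by_cases e : x = k
    · subst e; simp
    · simpa [e] using hx x (by omega)
  · rintro s' ⟨hs', h7, hx⟩ -
    exact ⟨⟨hs', .init n _ (fun r hr => (hx r hr).2.2) (fun r hr => (hx r hr).2.1)
      fun r hr => (hx r hr).1⟩, h7⟩
  · simp only [Expr.cost]
    omega

theorem ends_check (hW : 20 * (n * n) + 20 * n + 20 < W) (hs : Good n E i s) :
    Ends W check s (40 * (n + 1)) fun s' => Ctx n E i s' ∧
      ((∀ l < n, Owns n s.mem l) → s'.reg 7 = s.reg 7) ∧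
      ((¬ ∀ l < n, Owns n s.mem l) → s'.reg 7 = 0) := by
  refine .forLoop n 30 (fun k s' => Good n E i s' ∧ s'.mem = s.mem ∧
      ((∀ l < k, Owns n s.mem l) → s'.reg 7 = s.reg 7) ∧
      ((¬ ∀ l < k, Owns n s.mem l) → s'.reg 7 = 0)) (by omega)
    ⟨hs.setReg 0 (by decide) (by decide), rfl, by simp, by simp⟩ ?_ ?_ ?_ ?_
  · rintro j s' hj ⟨hs', -⟩ -
    have := hs'.reg_zero
    simp only [Expr.Fits, Expr.val]
    omega
  · rintro k s' hk ⟨hs', hm, h1, h2⟩ h3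
    obtain ⟨f, v⟩ := ownsExpr_spec hW hs' h3 hk
    rw [hm] at v
    change _ ↔ Owns n s.mem k at v
    have hsucc : (∀ l < k + 1, Owns n s.mem l) ↔ (∀ l < k, Owns n s.mem l) ∧ Owns n s.mem k :=
      Nat.forall_lt_succ_right
    refine .ite 2 f (fun hb => .skip (by decide) ?_)
      (fun hb => .assign (by simp only [Expr.Fits]; omega) (by decide) ?_) (by decide)
    · rw [v] at hb
      refine ⟨h3, hs'.setReg _ (by decide) (by decide), hm, ?_⟩
      rw [hsucc]
      simpa [hb] using ⟨h1, by simpa using h2⟩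
    · have hb' : ¬ Owns n s.mem k := mt v.2 (not_not.2 hb)
      refine ⟨by simpa using h3, (hs'.setReg _ (by decide) (by decide)).setReg _ (by decide)
        (by decide), hm, ?_⟩
      rw [hsucc]
      simp [hb', Expr.val]
  · rintro s' ⟨hs', -, h⟩ -
    exact ⟨hs'.toCtx, h⟩
  · simp only [Expr.cost]
    omega

theorem ends_checkCondition (hW : 20 * (n * n) + 20 * n + 20 < W) (hE : ∀ a, E a ≤ 1)
    (h0 : s.reg 0 = n) (hmem : ∀ a < 2 * (n * n), s.mem a = E a) :
    Ends W checkCondition s (2000 * (n + 1) ^ 5) fun s' =>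
      ((∀ i < n, HasMatching n (Compatible E n i)) → s'.reg 0 = 1) ∧
      ((¬ ∀ i < n, HasMatching n (Compatible E n i)) → s'.reg 0 = 0) := by
  -- The time for one vertex: the auction, plus `120(n + 1)` for the reset and `40(n + 1)` for the
  -- check.
  set B := 1200 * ((n + 1) * (n + 1)) * ((n + 1) * (n + 1)) + 160 * (n + 1) with hB
  have hBn : n * (B + 8) + 10 ≤ 2000 * (n + 1) ^ 5 := by
    obtain ⟨y, hy⟩ : ∃ y, y = (n + 1) * ((n + 1) * ((n + 1) * (n + 1))) := ⟨_, rfl⟩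
    have hy' : n + 1 ≤ y := hy ▸ Nat.le_mul_of_pos_right _ (by positivity)
    have e : 2000 * (n + 1) ^ 5 = (n + 1) * (2000 * y) := by rw [hy]; ring
    have e' : B = 1200 * y + 160 * (n + 1) := by rw [hB, hy]; ring
    rw [e]
    calc n * (B + 8) + 10 ≤ n * (2000 * y) + 2000 * y :=
          add_le_add (Nat.mul_le_mul_left _ (by omega)) (by omega)
      _ = _ := by ring
  refine .seq 2 (n * (B + 8) + 8) (.assign (by simp only [Expr.Fits]; omega) (by decide) ?_)
    (by omega)
  refine .seq (n * (B + 8) + 6) 2 (.forLoop n B (fun k s' => s'.reg 0 = n ∧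
      (∀ a < 2 * (n * n), s'.mem a = E a) ∧
      ((∀ i < k, HasMatching n (Compatible E n i)) → s'.reg 7 = 1) ∧
      ((¬ ∀ i < k, HasMatching n (Compatible E n i)) → s'.reg 7 = 0)) (by omega)
    ⟨by simpa using h0, hmem, by simp [Expr.val], by simp⟩ ?_ ?_ ?_ ?_) (by omega)
  · rintro j s' hj ⟨h0', -⟩ -
    simp only [Expr.Fits, Expr.val]
    omega
  · rintro i s₀ hi ⟨h0', hmem', h1, h2⟩ hx
    refine .seq (120 * (n + 1)) (B - 120 * (n + 1)) ((ends_reset hW ⟨h0', hx, hmem'⟩).mono le_rfl ?_)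
      (by omega)
    rintro s₁ ⟨hs₁, e₁⟩
    refine .seq (1200 * ((n + 1) * (n + 1)) * ((n + 1) * (n + 1))) (40 * (n + 1))
      ((ends_auction hW hE hs₁ hi).mono le_rfl ?_) (by omega)
    rintro s₂ ⟨hs₂, e₂, hd⟩
    refine (ends_check hW hs₂).mono le_rfl ?_
    rintro s₃ ⟨hs₃, h3, h4⟩
    have hiff : HasMatching n (Compatible E n i) ↔ ∀ l < n, Owns n s₂.mem l :=
      hs₂.inv.hasMatching_iff hd
    rw [← hiff, e₂, e₁] at h3
    rw [← hiff] at h4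
    refine ⟨hs₃.reg_one, by simpa using hs₃.reg_zero, hs₃.mem, ?_⟩
    rw [Nat.forall_lt_succ_right]
    simp only [State.setReg_reg, Nat.reduceEqDiff, reduceIte]
    constructor
    · rintro ⟨a, b⟩
      rw [h3 b, h1 a]
    · intro hno
      by_cases b : HasMatching n (Compatible E n i)
      · rw [h3 b]
        exact h2 fun a => hno ⟨a, b⟩
      · exact h4 b
  · rintro s' ⟨h0', -, h⟩ -
    refine .assign ?_ (by decide) (by simpa [Expr.val] using h)
    have : s'.reg 7 ≤ 1 := by
      by_cases a : ∀ i < n, HasMatching n (Compatible E n i)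
      · rw [h.1 a]
      · rw [h.2 a]; omega
    simp only [Expr.Fits]
    omega
  · change n * (B + 8) + 1 + 5 ≤ _
    omega

end RAM

/-! ### Correctness of the encoding -/

namespace MixedGraph

variable {V : Type*} {n : ℕ}

theorem input_mem_le_one (G : MixedGraph V) (e : V ≃ Fin n) (a : ℕ) : (G.input e).mem a ≤ 1 := by
  simp only [input]
  split <;> omega

theorem mul_add_inj {a b a' b' : ℕ} (hb : b < n) (hb' : b' < n) (h : a * n + b = a' * n + b') :
    a = a' ∧ b = b' := by
  have hn : 0 < n := by omega
  have h1 := congrArg (· / n) h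
  have h2 := congrArg (· % n) h
  simp only [Nat.mul_add_mod', Nat.mod_eq_of_lt hb, Nat.mod_eq_of_lt hb'] at h2
  simp only [Nat.mul_comm _ n, Nat.mul_add_div hn, Nat.div_eq_of_lt hb, Nat.div_eq_of_lt hb'] at h1
  exact ⟨by simpa using h1, h2⟩

theorem input_mem_dir (G : MixedGraph V) (e : V ≃ Fin n) (u v : V) :
    (G.input e).mem ((e u : ℕ) * n + e v) ≠ 0 ↔ G.Dir u v := by
  simp only [input, ne_eq, ite_eq_right_iff, one_ne_zero, imp_false, not_not]
  constructor
  · rintro (⟨u', v', h, he⟩ | ⟨u', v', -, he⟩)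
    · obtain ⟨h1, h2⟩ := mul_add_inj (e v).2 (e v').2 he
      rwa [e.injective (Fin.ext h1), e.injective (Fin.ext h2)]
    · have : ((e u : ℕ) + 1) * n ≤ n * n := Nat.mul_le_mul_right n (e u).2
      rw [Nat.succ_mul] at this
      have := (e v).2
      omega
  · exact fun h => .inl ⟨u, v, h, rfl⟩

theorem input_mem_bi (G : MixedGraph V) (e : V ≃ Fin n) (u v : V) :
    (G.input e).mem ((n + e u) * n + e v) ≠ 0 ↔ G.Bi.Adj u v := by
  simp only [input, ne_eq, ite_eq_right_iff, one_ne_zero, imp_false, not_not]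
  have h : (n + (e u : ℕ)) * n + e v = n * n + ((e u : ℕ) * n + e v) := by ring
  rw [h]
  constructor
  · rintro (⟨u', v', h, he⟩ | ⟨u', v', h, he⟩)
    · have : ((e u' : ℕ) + 1) * n ≤ n * n := Nat.mul_le_mul_right n (e u').2
      rw [Nat.succ_mul] at this
      have := (e v').2
      omega
    · obtain ⟨h1, h2⟩ := mul_add_inj (e v).2 (e v').2 (Nat.add_left_cancel he)
      rwa [e.injective (Fin.ext h1), e.injective (Fin.ext h2)]
  · exact fun h => .inr ⟨u, v, h, rfl⟩

/-- The bipartite graph of the auction for `i` in terms of vertices. -/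
def VertexCompatible (G : MixedGraph V) (i v : V) : V ⊕ V → Prop
  | .inl u => ¬ G.Dir u i ∧ (u = i ↔ v = i) ∧ (u = v ∨ G.Dir u v)
  | .inr u => ¬ G.Bi.Adj u i ∧ (u = i ↔ v = i) ∧ (u = v ∨ G.Bi.Adj u v)

/-- The two adjacency matrices lie one behind the other and form a single `2n × n` matrix. Row `u`
holds the directed edges out of `u` and row `n + u` the bi-directed ones, so one test on `r * n + l`
serves both kinds of objects. -/
theorem compatible_iff (G : MixedGraph V) (e : V ≃ Fin n) (i v : V) (x : V ⊕ V) :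
    RAM.Compatible (G.input e).mem n (e i) (e v) (finSumFinEquiv (Sum.map e e x)) ↔
      G.VertexCompatible i v x := by
  have hinj : ∀ {u v : V}, (e u : ℕ) = e v ↔ u = v := by
    intro u v
    rw [← Fin.ext_iff, e.apply_eq_iff_eq]
  have hlt : ∀ {u v : V}, (e u : ℕ) ≠ n + e v := by
    intro u v
    have := (e u).2
    omega
  rcases x with u | u
  · simp only [RAM.Compatible, VertexCompatible, Sum.map_inl, finSumFinEquiv_apply_left,
      Fin.val_castAdd, hinj, hlt, false_or, or_false, input_mem_dir, ← not_ne_iff (b := 0)]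
  · simp only [RAM.Compatible, VertexCompatible, Sum.map_inr, finSumFinEquiv_apply_right,
      Fin.val_natAdd, hinj, hlt.symm, false_or, input_mem_bi, ← not_ne_iff (b := 0),
      Nat.add_left_cancel_iff]

theorem hasMatching_iff (G : MixedGraph V) (e : V ≃ Fin n) (i : V) :
    HasMatching n (RAM.Compatible (G.input e).mem n (e i)) ↔
      ∃ f : V → V ⊕ V, Function.Injective f ∧ ∀ v, G.VertexCompatible i v (f v) := by
  let c : V ⊕ V ≃ Fin (n + n) := (e.sumCongr e).trans finSumFinEquiv
  have hc : ∀ x, finSumFinEquiv (Sum.map e e x) = c x := fun x => rfl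
  constructor
  · rintro ⟨g, hg, hga⟩
    have hlt : ∀ v, g (e v) < n + n := fun v => by
      have := (hga (e v) (e v).2).1
      omega
    refine ⟨fun v => c.symm ⟨g (e v), hlt v⟩, fun v w h => ?_, fun v => ?_⟩
    · have := Fin.ext_iff.1 (c.symm.injective h)
      exact e.injective (Fin.ext (hg (e v).2 (e w).2 this))
    · rw [← compatible_iff G e, hc, Equiv.apply_symm_apply]
      exact (hga (e v) (e v).2).2
  -- The value `0` outside the range is irrelevant, since a matching is only constrained below `n`.
  · rintro ⟨f, hf, hfa⟩
    refine ⟨fun l => if h : l < n then c (f (e.symm ⟨l, h⟩)) else 0, fun l hl l' hl' h => ?_,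
      fun l hl => ?_⟩
    · rw [Set.mem_Iio] at hl hl'
      simp only [hl, hl', dite_true] at h
      simpa using e.symm.injective (hf (c.injective (Fin.ext h)))
    · simp only [hl, dite_true]
      refine ⟨by have := (c (f (e.symm ⟨l, hl⟩))).2; omega, ?_⟩
      have := (compatible_iff G e i _ _).2 (hfa (e.symm ⟨l, hl⟩))
      rwa [hc, Equiv.apply_symm_apply] at this

/-- Keeping `i` as a bidder avoids renumbering `V \ {i}`. It can always take `inl i`, as there are
no self-loops, and no other vertex may use a copy of `i`, so restriction to `V \ {i}` loses nothing.
-/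
theorem exists_vertexCompatible_iff (G : MixedGraph V) (i : V) :
    (∃ f : V → V ⊕ V, Function.Injective f ∧ ∀ v, G.VertexCompatible i v (f v)) ↔
      ∃ f : ({i}ᶜ : Set V) → ({i}ᶜ : Set V) ⊕ ({i}ᶜ : Set V), Function.Injective f ∧
        ∀ v, (G.induce {i}ᶜ).IsPred (Subtype.val ⁻¹' (G.pa i ∪ {i})ᶜ) (Subtype.val ⁻¹' G.sib i) v
          (f v) := by
  classical
  constructor
  · rintro ⟨f, hf, hfa⟩
    have : ∀ v : ({i}ᶜ : Set V), ∃ x : ({i}ᶜ : Set V) ⊕ ({i}ᶜ : Set V),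
        Sum.map (↑) (↑) x = f v ∧ (G.induce {i}ᶜ).IsPred (Subtype.val ⁻¹' (G.pa i ∪ {i})ᶜ)
          (Subtype.val ⁻¹' G.sib i) v x := by
      intro v
      have hv : (v : V) ≠ i := v.2
      have h := hfa v
      rcases e : f v with u | u <;> rw [e] at h <;> obtain ⟨h1, h2, h3⟩ := h
      · have hu : u ≠ i := mt h2.1 hv
        refine ⟨.inl ⟨u, hu⟩, rfl, ?_, h3.imp_left fun h => Subtype.ext h⟩
        simpa [pa, hu] using h1
      · have hu : u ≠ i := mt h2.1 hv
        exact ⟨.inr ⟨u, hu⟩, rfl, h1, h3.imp_left fun h => Subtype.ext h⟩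
    choose g hg hga using this
    refine ⟨g, fun v w h => ?_, hga⟩
    have := hg v
    rw [h, hg w] at this
    exact Subtype.ext (hf this).symm
  · rintro ⟨f, hf, hfa⟩
    have hval : Function.Injective (Sum.map (↑) (↑) :
        ({i}ᶜ : Set V) ⊕ ({i}ᶜ : Set V) → V ⊕ V) :=
      Sum.map_injective.2 ⟨Subtype.val_injective, Subtype.val_injective⟩
    have hne : ∀ x : ({i}ᶜ : Set V) ⊕ ({i}ᶜ : Set V), Sum.map (↑) (↑) x ≠ (.inl i : V ⊕ V) := by
      rintro (u | u) h
      · exact u.2 (Sum.inl.inj h)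
      · cases h
    refine ⟨fun v => if h : v = i then .inl i else Sum.map (↑) (↑) (f ⟨v, h⟩), fun v w h => ?_,
      fun v => ?_⟩
    · by_cases hv : v = i <;> by_cases hw : w = i <;> simp only [hv, hw, dite_true, dite_false] at h
      · rw [hv, hw]
      · exact absurd h.symm (hne _)
      · exact absurd h (hne _)
      · exact congrArg Subtype.val (hf (hval h))
    · by_cases hv : v = i
      · subst hv
        simp only [dite_true]
        exact ⟨G.dir_irrefl v, Iff.rfl, .inl rfl⟩
      · simp only [hv, dite_false]
        have h := hfa ⟨v, hv⟩
        rcases e : f ⟨v, hv⟩ with u | u <;> rw [e] at h <;> obtain ⟨h1, h2⟩ := h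
        · refine ⟨fun h => h1 (.inl h), ⟨fun h => absurd h u.2, fun h => absurd h hv⟩,
            h2.imp_left fun h => congrArg Subtype.val h⟩
        · exact ⟨h1, ⟨fun h => absurd h u.2, fun h => absurd h hv⟩,
            h2.imp_left fun h => congrArg Subtype.val h⟩

theorem graphicalCondition_iff (G : MixedGraph V) (e : V ≃ Fin n) :
    G.GraphicalCondition ↔ ∀ i < n, HasMatching n (RAM.Compatible (G.input e).mem n i) := by
  have : Finite V := .of_equiv _ e.symm
  have key : ∀ i, (∃ Sb : Set ({i}ᶜ : Set V), Sb ⊆ Subtype.val ⁻¹' (G.pa i ∪ {i})ᶜ ∧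
      ∃ S : (G.induce {i}ᶜ).HalfColliderSystem Sb (Subtype.val ⁻¹' G.sib i),
        Pairwise fun k l => Disjoint (S.path k).portion (S.path l).portion) ↔
      HasMatching n (RAM.Compatible (G.input e).mem n (e i)) := by
    intro i
    rw [hasMatching_iff, exists_vertexCompatible_iff]
    constructor
    · rintro ⟨Sb, hSb, S, hS⟩
      exact exists_injective_isPred_of_system hSb S hS
    · rintro ⟨f, hf, hfa⟩
      exact exists_system_of_injective_isPred hf hfa
  refine (forall_congr' key).trans ⟨fun h i hi => ?_, fun h i => h _ (e i).2⟩
  simpa using h (e.symm ⟨i, hi⟩)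

end MixedGraph

/-- One RAM program with words of `O(log |V|)` bits checks the graphical condition for all finite
mixed graphs in `O(|V|⁵)` operations; register `0` holds the answer (`1` for yes, `0` for no). -/
theorem mainTheorem6 :
    ∃ (P : RAM.Prog) (c : ℕ) (T : ℕ → ℕ),
      Asymptotics.IsBigO Filter.atTop (fun n : ℕ => (T n : ℝ)) (fun n : ℕ => (n : ℝ) ^ 5) ∧
      ∀ (V : Type*) [Fintype V] (G : MixedGraph V) (e : V ≃ Fin (Fintype.card V)),
        ∃ (t : ℕ) (s : RAM.State),
          RAM.Exec ((Fintype.card V + 2) ^ c) P (G.input e) t s ∧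
          t ≤ T (Fintype.card V) ∧
          (G.GraphicalCondition → s.reg 0 = 1) ∧
          (¬ G.GraphicalCondition → s.reg 0 = 0) := by
  refine ⟨RAM.checkCondition, 7, fun n => 2000 * (n + 1) ^ 5, ?_, fun V _ G e => ?_⟩
  -- The factor `2 ^ 5` comes from `n + 1 ≤ 2n` for `n ≥ 1`.
  · refine Asymptotics.IsBigO.of_bound (2000 * 2 ^ 5) ?_
    filter_upwards [Filter.eventually_ge_atTop 1] with n hn
    have hn' : (1 : ℝ) ≤ n := by exact_mod_cast hn
    rw [Real.norm_of_nonneg (by positivity), Real.norm_of_nonneg (by positivity)]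
    push_cast
    rw [mul_assoc, ← mul_pow]
    gcongr
    linarith
  · have hW : ∀ n : ℕ, 20 * (n * n) + 20 * n + 20 < (n + 2) ^ 7 := by
      intro n
      -- The exponent `7` is `2` for the quadratic word bound plus `5` to absorb the constant `32 =
      -- 2 ^ 5`, which works even for `n = 0`.
      calc 20 * (n * n) + 20 * n + 20 < 2 ^ 5 * (n + 2) ^ 2 := by nlinarith
        _ ≤ (n + 2) ^ 5 * (n + 2) ^ 2 := by gcongr; omega
        _ = (n + 2) ^ 7 := by ring
    rw [G.graphicalCondition_iff e]
    exact RAM.ends_checkCondition (hW _) (G.input_mem_le_one e) (by simp [MixedGraph.input])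
      fun _ _ => rfl
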